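/- Fix $\beta>0$ and $\gamma\in\mathbb R$, and let $f:\mathbb N_0\to\mathbb R$ satisfy $\limsup_{i\to\infty}|f(i)|/i<\infty$. **Notation.** For a simple labelled graph $G$ on $n$ vertices let $E$ be its number of edges, $h_i$ the number of its vertices of degree $i$, and $\mu^{(n)}$ the probability measure with mass $h_i/n$ at $i$. For $n\ge\beta$ let $\mathbb Q_{n,\gamma f}$ be the probability measure on such graphs given by $$\mathbb Q_{n,\gamma f}(G)=\frac{1}{Z_n(\gamma f)}\Big(\frac{\beta}{n}\Big)^{E}\Big(1-\frac{\beta}{n}\Big)^{\binom n2-E}\exp\Big(\gamma\sum_{i=0}^{n-1}h_if(i)\Big),$$ where $Z_n(\gamma f)$ is the normalizing constant. Let $\mathcal S$ be the set of probability measures $\mu$ on $\mathbb N_0$ with finite mean $\overline\mu=\sum_i i\mu_i$, with the metric $d(\mu,\nu)=\sum_{i\ge1} i|\mu_i-\nu_i|$. For $\mu\in\mathcal S$ put $\mu(f)=\sum_i\mu_if(i)$ and (with $0\log0=0$) $$I(\mu)=\sum_{i=0}^\infty\mu_i\log(i!\,\mu_i)-\frac{\overline\mu}{2}\log(\overline\mu\beta)+\frac{\overline\mu+\beta}{2}\in(-\infty,\infty].$$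 For $\theta\ge0$ let $C(\theta)=\log\sum_{i\ge0}\theta^ie^{\gamma f(i)}/i!$, let $\sigma_{\theta}=\sigma_{\theta,\gamma f}\in\mathcal S$ be the measure with masses $e^{-C(\theta)}\theta^ie^{\gamma f(i)}/i!$, let $m(\theta)=\overline{\sigma_\theta}$, and let $$J(\gamma f)=\inf_{\theta\ge0}\{I(\sigma_\theta)-\gamma\sigma_\theta(f)\}.$$ **Theorem.** (a) As $n\to\infty$, $\frac1n\log Z_n(\gamma f)$ converges to a finite limit, and $$\lim_{n\to\infty}\frac1n\log Z_n(\gamma f)=\sup_{\mu\in\mathcal S}\{\gamma\mu(f)-I(\mu)\}=-J(\gamma f)=-\inf_{\theta\ge0}\Big\{m(\theta)\log\theta-C(\theta)-\frac{m(\theta)}2\log(m(\theta)\beta)+\frac{m(\theta)+\beta}2\Big\}.$$ (b) The set $A_{\gamma f}$ of all $\mu\in\mathcal S$ at which the supremum in (a) is attained is finite and non-empty, and $A_{\gamma f}\subset\{\sigma_{\theta,\gamma f}:\theta\ge0\}$. For every open $U\subset\mathcal S$ with $A_{\gamma f}\subset U$, $$\lim_{n\to\infty}\mathbb Q_{n,\gamma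 f}\big(\mu^{(n)}\notin U\big)=0.$$ -/

import Mathlib

open Filter Topology
open scoped NNReal

noncomputable section

namespace DegreeLDP

/-! ### Probability measures on `ℕ` with finite mean -/

/-- The set `𝒮` of probability measures on `{0, 1, 2, …}` with finite mean. -/
def FinMean : Type :=
  {p : PMF ℕ // Summable fun i : ℕ => (i : ℝ) * (p i).toReal}

namespace FinMean

/-- The mass `μ_i`, as a real number. -/
def mass (μ : FinMean) (i : ℕ) : ℝ := (μ.1 i).toReal

/-- The mean `∑ i μ_i`. -/
def mean (μ : FinMean) : ℝ := ∑' i : ℕ, (i : ℝ) * μ.mass i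

/-- `μ(f) = ∑ μ_i f(i)`; the series converges absolutely when `|f|` grows at most linearly. -/
def expect (μ : FinMean) (f : ℕ → ℝ) : ℝ := ∑' i : ℕ, μ.mass i * f i

lemma mass_nonneg (μ : FinMean) (i : ℕ) : 0 ≤ μ.mass i := ENNReal.toReal_nonneg

lemma hasSum_mass (μ : FinMean) : HasSum μ.mass 1 := by
  have h := ENNReal.hasSum_toReal (f := fun i => μ.1 i) (by rw [μ.1.tsum_coe]; simp)
  rw [← ENNReal.tsum_toReal_eq (fun i => μ.1.apply_ne_top i), μ.1.tsum_coe,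
    ENNReal.toReal_one] at h
  exact h

lemma summable_mean (μ : FinMean) : Summable fun i : ℕ => (i : ℝ) * μ.mass i := μ.2

lemma ext_mass {μ ν : FinMean} (h : ∀ i, μ.mass i = ν.mass i) : μ = ν := by
  apply Subtype.ext
  ext i
  exact (ENNReal.toReal_eq_toReal_iff' (μ.1.apply_ne_top i) (ν.1.apply_ne_top i)).1 (h i)

/-- The element of `𝒮` with prescribed masses. -/
def ofMass (a : ℕ → ℝ) (h0 : ∀ i, 0 ≤ a i) (h1 : HasSum a 1)
    (hm : Summable fun i : ℕ => (i : ℝ) * a i) : FinMean :=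
  ⟨⟨fun i => ENNReal.ofReal (a i), by
      have h := ENNReal.summable.hasSum (f := fun i => ENNReal.ofReal (a i))
      rwa [← ENNReal.ofReal_tsum_of_nonneg h0 h1.summable, h1.tsum_eq, ENNReal.ofReal_one] at h⟩,
    by
      refine hm.congr fun i => ?_
      change _ = (i : ℝ) * (ENNReal.ofReal (a i)).toReal
      rw [ENNReal.toReal_ofReal (h0 i)]⟩

lemma mass_ofMass (a : ℕ → ℝ) (h0 : ∀ i, 0 ≤ a i) (h1 : HasSum a 1)
    (hm : Summable fun i : ℕ => (i : ℝ) * a i) (i : ℕ) : (ofMass a h0 h1 hm).mass i = a i :=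
  ENNReal.toReal_ofReal (h0 i)

lemma summable_dist (μ ν : FinMean) :
    Summable fun i : ℕ => (i : ℝ) * |μ.mass i - ν.mass i| := by
  refine Summable.of_nonneg_of_le (fun i => by positivity) (fun i => ?_)
    (μ.summable_mean.add ν.summable_mean)
  have h : |μ.mass i - ν.mass i| ≤ μ.mass i + ν.mass i := by
    rw [abs_le]
    constructor <;> linarith [μ.mass_nonneg i, ν.mass_nonneg i]
  calc (i : ℝ) * |μ.mass i - ν.mass i| ≤ i * (μ.mass i + ν.mass i) := by gcongr
    _ = _ := by ring

/-- The metric `d(μ, ν) = ∑ i |μ_i - ν_i|` on `𝒮`. -/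
instance : MetricSpace FinMean where
  dist μ ν := ∑' i : ℕ, (i : ℝ) * |μ.mass i - ν.mass i|
  dist_self μ := by simp
  dist_comm μ ν := by
    simp_rw [abs_sub_comm]
  dist_triangle μ ν ρ := by
    rw [← (summable_dist μ ν).tsum_add (summable_dist ν ρ)]
    refine (summable_dist μ ρ).tsum_le_tsum (fun i => ?_)
      ((summable_dist μ ν).add (summable_dist ν ρ))
    rw [← mul_add]
    gcongr
    exact abs_sub_le _ _ _
  eq_of_dist_eq_zero := by
    intro μ ν h
    change (∑' i : ℕ, _) = (0 : ℝ) at h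
    have h0 := (hasSum_zero_iff_of_nonneg (fun i => by positivity)).1
      (h ▸ (summable_dist μ ν).hasSum)
    have hpos : ∀ i, i ≠ 0 → μ.mass i = ν.mass i := by
      intro i hi
      have := congrFun h0 i
      simp only [Pi.zero_apply, mul_eq_zero, Nat.cast_eq_zero, hi, false_or, abs_eq_zero] at this
      linarith
    apply ext_mass
    intro i
    by_cases hi : i = 0
    · subst hi
      have hs := μ.hasSum_mass.sub ν.hasSum_mass
      have hs' := hasSum_single (f := fun i => μ.mass i - ν.mass i) 0
        (fun i hi => by simp [hpos i hi])
      have := hs.unique hs'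
      linarith
    · exact hpos i hi

end FinMean

/-! ### The rate function -/

/-- The negative parts of the terms of `∑ μ_i log (i! μ_i)` are summable for every `μ ∈ 𝒮`, so
the series either converges absolutely or has the value `+∞`. -/
lemma summable_neg_part (μ : FinMean) :
    Summable fun i : ℕ => max (-(μ.mass i * Real.log (i.factorial * μ.mass i))) 0 := by
  have hg : Summable fun i : ℕ => ((1 : ℝ) / 2) ^ i := summable_geometric_two
  refine Summable.of_nonneg_of_le (fun i => le_max_right _ _) (fun i => ?_)
    ((μ.summable_mean.mul_left (Real.log 2)).add hg)
  have hx := μ.mass_nonneg i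
  have hlog : 0 ≤ Real.log 2 := Real.log_nonneg (by norm_num)
  apply max_le _ (by positivity)
  rcases hx.eq_or_lt with h | h
  · rw [← h]; simp
  have hf : (1 : ℝ) ≤ i.factorial := by exact_mod_cast i.factorial_pos
  have h1 : Real.log (μ.mass i) ≤ Real.log (i.factorial * μ.mass i) :=
    Real.log_le_log h (by nlinarith)
  have h2 := Real.add_one_le_exp (Real.log (((1 : ℝ) / 2) ^ i / μ.mass i))
  rw [Real.exp_log (by positivity), Real.log_div (by positivity) h.ne', Real.log_pow,
    one_div, Real.log_inv] at h2
  have h3 : μ.mass i * (i * -Real.log 2 - Real.log (μ.mass i) + 1)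
      ≤ μ.mass i * ((2 : ℝ)⁻¹ ^ i / μ.mass i) := by gcongr
  rw [mul_div_cancel₀ _ h.ne'] at h3
  rw [one_div]
  nlinarith [mul_le_mul_of_nonneg_left h1 hx]

open Classical in
/-- The rate function
`I(μ) = ∑ μ_i log (i! μ_i) - (μ̄ / 2) log (μ̄ β) + (μ̄ + β) / 2`, with `0 log 0 = 0`. It is `+∞`
exactly when the series diverges (its negative part always converges). -/
def rate (β : ℝ) (μ : FinMean) : EReal :=
  if Summable fun i : ℕ => μ.mass i * Real.log (i.factorial * μ.mass i) then
    (((∑' i : ℕ, μ.mass i * Real.log (i.factorial * μ.mass i))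
      - μ.mean / 2 * Real.log (μ.mean * β) + (μ.mean + β) / 2 : ℝ) : EReal)
  else ⊤

/-! ### The exponential family `σ_{θ,f}` -/

/-- `limsup |f(i)| / i < ∞`. -/
def LinearGrowth (f : ℕ → ℝ) : Prop :=
  limsup (fun i : ℕ => ((|f i| / i : ℝ) : EReal)) atTop < ⊤

lemma linearGrowth_iff (f : ℕ → ℝ) :
    LinearGrowth f ↔ ∃ C : ℝ, 0 ≤ C ∧ ∀ i : ℕ, |f i| ≤ C * (i + 1) := by
  constructor
  · intro h
    obtain ⟨c, hc1, hc2⟩ := EReal.exists_rat_btwn_of_lt h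
    have hev := eventually_lt_of_limsup_lt hc1
    have hO : f =O[atTop] fun i : ℕ => (i : ℝ) + 1 := by
      apply Asymptotics.IsBigO.of_bound (c : ℝ)
      filter_upwards [hev, eventually_gt_atTop 0] with i hi hpos
      have hi' : |f i| / i < (c : ℝ) := by exact_mod_cast hi
      have hip : (0 : ℝ) < i := by exact_mod_cast hpos
      have hc0 : (0 : ℝ) ≤ c := le_trans (by positivity) hi'.le
      rw [div_lt_iff₀ hip] at hi'
      rw [Real.norm_eq_abs, Real.norm_eq_abs, abs_of_pos (by positivity : (0 : ℝ) < (i : ℝ) + 1)]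
      nlinarith
    obtain ⟨C, hC, hb⟩ := Asymptotics.bound_of_isBigO_nat_atTop hO
    refine ⟨C, hC.le, fun i => ?_⟩
    have hi : (0 : ℝ) < (i : ℝ) + 1 := by positivity
    simpa [abs_of_pos hi] using hb (x := i) hi.ne'
  · rintro ⟨C, hC, hb⟩
    refine lt_of_le_of_lt (limsup_le_of_le (a := ((2 * C : ℝ) : EReal)) (by isBoundedDefault) ?_)
      (EReal.coe_lt_top _)
    filter_upwards [eventually_gt_atTop 0] with i hpos
    have hip : (1 : ℝ) ≤ i := by exact_mod_cast hpos
    rw [EReal.coe_le_coe_iff, div_le_iff₀ (by linarith)]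
    nlinarith [hb i]

lemma LinearGrowth.const_smul {f : ℕ → ℝ} (hf : LinearGrowth f) (γ : ℝ) :
    LinearGrowth (γ • f) := by
  obtain ⟨C, hC, hb⟩ := (linearGrowth_iff f).1 hf
  refine (linearGrowth_iff _).2 ⟨|γ| * C, by positivity, fun i => ?_⟩
  rw [Pi.smul_apply, smul_eq_mul, abs_mul, mul_assoc]
  gcongr
  exact hb i

/-- The unnormalized weight `θ^i e^{f(i)} / i!`. -/
def sigmaWeight (f : ℕ → ℝ) (θ : ℝ≥0) (i : ℕ) : ℝ :=
  (θ : ℝ) ^ i * Real.exp (f i) / i.factorial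

lemma summable_mul_sigmaWeight {f : ℕ → ℝ} (hf : LinearGrowth f) (θ : ℝ≥0) :
    Summable fun i : ℕ => ((i : ℝ) + 1) * sigmaWeight f θ i := by
  obtain ⟨C, hC, hb⟩ := (linearGrowth_iff f).1 hf
  have hs := (Real.summable_pow_div_factorial (2 * θ * Real.exp C)).mul_left (Real.exp C)
  refine Summable.of_nonneg_of_le (fun i => by unfold sigmaWeight; positivity) (fun i => ?_) hs
  have h1 : ((i : ℝ) + 1) ≤ 2 ^ i := by exact_mod_cast i.lt_two_pow_self
  have h2 : Real.exp (f i) ≤ Real.exp C ^ i * Real.exp C := by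
    rw [← Real.exp_nat_mul, ← Real.exp_add]
    apply Real.exp_le_exp.2
    linarith [le_abs_self (f i), hb i]
  calc ((i : ℝ) + 1) * ((θ : ℝ) ^ i * Real.exp (f i) / i.factorial)
      ≤ 2 ^ i * ((θ : ℝ) ^ i * (Real.exp C ^ i * Real.exp C) / i.factorial) := by gcongr
    _ = _ := by rw [mul_pow, mul_pow]; ring

lemma sigmaWeight_nonneg (f : ℕ → ℝ) (θ : ℝ≥0) (i : ℕ) : 0 ≤ sigmaWeight f θ i := by
  unfold sigmaWeight; positivity

lemma summable_sigmaWeight {f : ℕ → ℝ} (hf : LinearGrowth f) (θ : ℝ≥0) :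
    Summable (sigmaWeight f θ) := by
  refine Summable.of_nonneg_of_le (sigmaWeight_nonneg f θ) (fun i => ?_)
    (summable_mul_sigmaWeight hf θ)
  have h : (0 : ℝ) ≤ i := by positivity
  nlinarith [sigmaWeight_nonneg f θ i]

lemma tsum_sigmaWeight_pos {f : ℕ → ℝ} (hf : LinearGrowth f) (θ : ℝ≥0) :
    0 < ∑' i, sigmaWeight f θ i :=
  (summable_sigmaWeight hf θ).tsum_pos (sigmaWeight_nonneg f θ) 0
    (by simp [sigmaWeight, Real.exp_pos])

/-- `C(θ, f) = log ∑ θ^i e^{f(i)} / i!`. -/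
def logPartition (f : ℕ → ℝ) (θ : ℝ≥0) : ℝ := Real.log (∑' i, sigmaWeight f θ i)

/-- The measure `σ_{θ,f} ∈ 𝒮`, with masses `e^{-C(θ,f)} θ^i e^{f(i)} / i!`. -/
def sigma (f : ℕ → ℝ) (hf : LinearGrowth f) (θ : ℝ≥0) : FinMean :=
  FinMean.ofMass (fun i => Real.exp (-logPartition f θ) * sigmaWeight f θ i)
    (fun i => mul_nonneg (Real.exp_pos _).le (sigmaWeight_nonneg f θ i))
    (by
      have h := (summable_sigmaWeight hf θ).hasSum.mul_left (Real.exp (-logPartition f θ))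
      have hZ := tsum_sigmaWeight_pos hf θ
      have he : Real.exp (-logPartition f θ) * ∑' i, sigmaWeight f θ i = 1 := by
        rw [Real.exp_neg, logPartition, Real.exp_log hZ, inv_mul_cancel₀ hZ.ne']
      rwa [he] at h)
    (by
      have h := ((summable_mul_sigmaWeight hf θ).sub (summable_sigmaWeight hf θ)).mul_left
        (Real.exp (-logPartition f θ))
      exact h.congr fun i => by ring)

/-- `Ω_f = {σ_{θ,f} : θ ≥ 0}`. -/
def Omega (f : ℕ → ℝ) (hf : LinearGrowth f) : Set FinMean := Set.range (sigma f hf)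

/-- `J(f) = inf_{θ ≥ 0} {I(σ_{θ,f}) - σ_{θ,f}(f)}`. -/
def J (β : ℝ) (f : ℕ → ℝ) (hf : LinearGrowth f) : EReal :=
  ⨅ θ : ℝ≥0, (rate β (sigma f hf θ) - (((sigma f hf θ).expect f : ℝ) : EReal))

/-- The explicit function of `θ`, where `m(θ)` is the mean of `σ_{θ,f}`:
`m(θ) log θ - C(θ,f) - (m(θ)/2) log (m(θ) β) + (m(θ) + β)/2`. -/
def H (β : ℝ) (f : ℕ → ℝ) (hf : LinearGrowth f) (θ : ℝ≥0) : ℝ :=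
  (sigma f hf θ).mean * Real.log θ - logPartition f θ
    - (sigma f hf θ).mean / 2 * Real.log ((sigma f hf θ).mean * β)
    + ((sigma f hf θ).mean + β) / 2

/-! ### Random graphs -/

open Classical in
/-- `h_i`, the number of vertices of degree `i`. -/
def degFreq {n : ℕ} (G : SimpleGraph (Fin n)) (i : ℕ) : ℕ :=
  (Finset.univ.filter fun v : Fin n => G.degree v = i).card

lemma degFreq_eq_zero {n : ℕ} (G : SimpleGraph (Fin n)) {i : ℕ} (hi : i ∉ Finset.range n) :
    degFreq G i = 0 := by
  classical
  rw [degFreq, Finset.card_eq_zero, Finset.filter_eq_empty_iff]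
  intro v _ hv
  apply hi
  have h := G.degree_lt_card_verts v
  rw [Fintype.card_fin] at h
  rw [Finset.mem_range, ← hv]
  convert h

lemma sum_degFreq {n : ℕ} (G : SimpleGraph (Fin n)) :
    ∑ i ∈ Finset.range n, degFreq G i = n := by
  classical
  have h := Finset.card_eq_sum_card_fiberwise (s := (Finset.univ : Finset (Fin n)))
    (t := Finset.range n) (f := fun v => G.degree v) (fun v _ => by
      have h := G.degree_lt_card_verts v
      rw [Fintype.card_fin] at h
      simpa using h)
  rw [Finset.card_univ, Fintype.card_fin] at h
  refine Eq.trans (Finset.sum_congr rfl fun i _ => ?_) h.symm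
  unfold degFreq
  congr!

/-- The empirical degree distribution `μ^{(n)}`, with mass `h_i / n` at `i`. -/
def empirical {n : ℕ} [NeZero n] (G : SimpleGraph (Fin n)) : FinMean :=
  FinMean.ofMass (fun i => (degFreq G i : ℝ) / n) (fun i => by positivity)
    (by
      have h : HasSum (fun i => (degFreq G i : ℝ) / n)
          (∑ i ∈ Finset.range n, (degFreq G i : ℝ) / n) :=
        hasSum_sum_of_ne_finset_zero (fun i hi => by simp [degFreq_eq_zero G hi])
      rwa [← Finset.sum_div, ← Nat.cast_sum, sum_degFreq,
        div_self (Nat.cast_ne_zero.2 (NeZero.ne n))] at h)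
    (summable_of_ne_finset_zero (s := Finset.range n)
      (fun i hi => by simp [degFreq_eq_zero G hi]))

/-- The unnormalized mass
`(β/n)^E (1 - β/n)^{binom(n,2) - E} exp (∑ h_i f(i))` of the graph `G`. -/
def graphWeight (β : ℝ) (f : ℕ → ℝ) {n : ℕ} (G : SimpleGraph (Fin n)) : ℝ :=
  (β / n) ^ G.edgeSet.ncard * (1 - β / n) ^ (n.choose 2 - G.edgeSet.ncard)
    * Real.exp (∑ i ∈ Finset.range n, (degFreq G i : ℝ) * f i)

open Classical in
/-- The normalizing constant `Z_n(f)`. -/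
def Z (β : ℝ) (f : ℕ → ℝ) (n : ℕ) : ℝ := ∑ G : SimpleGraph (Fin n), graphWeight β f G

open Classical in
/-- The probability of a set of graphs under `ℚ_{n,f}` (a probability measure once `β ≤ n`). -/
def Q (β : ℝ) (f : ℕ → ℝ) (n : ℕ) (A : Set (SimpleGraph (Fin n))) : ℝ :=
  ∑ G : SimpleGraph (Fin n) with G ∈ A, graphWeight β f G / Z β f n

/-- The set of those `μ ∈ 𝒮` that maximize `γ μ(f) - I(μ)`. -/
def maximizers (β γ : ℝ) (f : ℕ → ℝ) : Set FinMean :=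
  {μ | ((γ * μ.expect f : ℝ) : EReal) - rate β μ
    = ⨆ ν : FinMean, (((γ * ν.expect f : ℝ) : EReal) - rate β ν)}

end DegreeLDP

end

noncomputable section

namespace DegreeLDP

/-! ### Counting edge sets by residual degrees -/

section EdgeSets

open Finset

variable {n : ℕ}

/-- The possible edges of a simple graph on `Fin n`. -/
def allEdges (n : ℕ) : Finset (Sym2 (Fin n)) := univ.filter fun e => ¬ e.IsDiag

/-- The number of edges in `A` that contain `v`. -/
def edgeDeg (A : Finset (Sym2 (Fin n))) (v : Fin n) : ℕ := (A.filter fun e => v ∈ e).card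

/-- The product of the falling factorials `d_v (d_v - 1) ⋯ (d_v - deg v + 1)`. -/
def stubCount (d : Fin n → ℕ) (A : Finset (Sym2 (Fin n))) : ℕ :=
  ∏ v, (d v).descFactorial (edgeDeg A v)

/-- The number of partial matchings with `j` edges of the half-edges prescribed by `d`, no two of
which join the same vertices and none of which is a loop. -/
def matchingCount (d : Fin n → ℕ) (j : ℕ) : ℕ :=
  ∑ A ∈ (allEdges n).powersetCard j, stubCount d A

lemma sum_powersetCard_insert {α : Type*} [DecidableEq α] (s : Finset α) (j : ℕ)
    (φ : Finset α → ℕ) :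
    ∑ A ∈ s.powersetCard j, ∑ e ∈ s \ A, φ (insert e A)
      = (j + 1) * ∑ B ∈ s.powersetCard (j + 1), φ B := by
  have h : (j + 1) * ∑ B ∈ s.powersetCard (j + 1), φ B
      = ∑ B ∈ s.powersetCard (j + 1), ∑ _e ∈ B, φ B := by
    rw [mul_sum]
    refine sum_congr rfl fun B hB => ?_
    rw [sum_const, (mem_powersetCard.1 hB).2, smul_eq_mul]
  rw [h, sum_sigma', sum_sigma']
  refine sum_bij' (fun x _ => ⟨insert x.2 x.1, x.2⟩) (fun x _ => ⟨x.1.erase x.2, x.2⟩)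
    ?_ ?_ ?_ ?_ ?_
  · rintro ⟨A, e⟩ h
    simp only [mem_sigma, mem_powersetCard, Finset.mem_sdiff] at h ⊢
    refine ⟨⟨insert_subset h.2.1 h.1.1, ?_⟩, mem_insert_self _ _⟩
    rw [card_insert_of_notMem h.2.2, h.1.2]
  · rintro ⟨B, e⟩ h
    simp only [mem_sigma, mem_powersetCard, Finset.mem_sdiff] at h ⊢
    refine ⟨⟨(erase_subset _ _).trans h.1.1, ?_⟩, h.1.1 h.2, notMem_erase _ _⟩
    rw [card_erase_of_mem h.2, h.1.2, Nat.add_sub_cancel]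
  · rintro ⟨A, e⟩ h
    simp only [mem_sigma, mem_powersetCard, Finset.mem_sdiff] at h
    simp [erase_insert h.2.2]
  · rintro ⟨B, e⟩ h
    simp only [mem_sigma] at h
    simp [insert_erase h.2]
  · simp

lemma edgeDeg_insert {A : Finset (Sym2 (Fin n))} {e : Sym2 (Fin n)} (he : e ∉ A) (v : Fin n) :
    edgeDeg (insert e A) v = edgeDeg A v + if v ∈ e then 1 else 0 := by
  unfold edgeDeg
  rw [filter_insert]
  split_ifs with h
  · rw [card_insert_of_notMem (by simp [he])]
  · simp

/-- The product of `r` over the two ends of `e`. -/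
def endProd (r : Fin n → ℕ) (e : Sym2 (Fin n)) : ℕ := ∏ v, if v ∈ e then r v else 1

lemma endProd_mk (r : Fin n → ℕ) {u v : Fin n} (h : u ≠ v) : endProd r s(u, v) = r u * r v := by
  unfold endProd
  rw [← prod_filter, show (univ.filter fun w => w ∈ s(u, v)) = {u, v} by ext; simp, prod_pair h]

lemma stubCount_insert (d : Fin n → ℕ) {A : Finset (Sym2 (Fin n))} {e : Sym2 (Fin n)}
    (he : e ∉ A) :
    stubCount d (insert e A) = stubCount d A * endProd (fun v => d v - edgeDeg A v) e := by
  unfold stubCount endProd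
  rw [← prod_mul_distrib]
  refine prod_congr rfl fun v _ => ?_
  rw [edgeDeg_insert he]
  split_ifs
  · rw [Nat.descFactorial_succ, mul_comm]
  · simp

lemma succ_mul_matchingCount_succ (d : Fin n → ℕ) (j : ℕ) :
    (j + 1) * matchingCount d (j + 1) = ∑ A ∈ (allEdges n).powersetCard j,
      stubCount d A * ∑ e ∈ allEdges n \ A, endProd (fun v => d v - edgeDeg A v) e := by
  unfold matchingCount
  rw [← sum_powersetCard_insert]
  refine sum_congr rfl fun A _ => ?_
  rw [mul_sum]
  exact sum_congr rfl fun e he => stubCount_insert d (Finset.mem_sdiff.1 he).2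

lemma two_mul_sum_endProd_add (r : Fin n → ℕ) :
    2 * ∑ e ∈ allEdges n, endProd r e + ∑ v, r v * r v = (∑ v, r v) * ∑ v, r v := by
  have h1 : ∑ e ∈ allEdges n, endProd r e
      = ∑ p ∈ (univ : Finset (Fin n)).offDiag with p.1 < p.2, r p.1 * r p.2 := by
    rw [allEdges, ← Finset.sym2_univ, sum_sym2_filter_not_isDiag]
    refine sum_congr rfl fun p hp => endProd_mk r ?_
    simp only [mem_filter, mem_offDiag] at hp
    exact hp.1.2.2
  have h2 : ∑ p ∈ (univ : Finset (Fin n)).offDiag with p.1 < p.2, r p.1 * r p.2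
      = ∑ p ∈ (univ : Finset (Fin n)).offDiag with ¬ p.1 < p.2, r p.1 * r p.2 := by
    refine sum_bij' (fun p _ => p.swap) (fun p _ => p.swap) ?_ ?_ (by simp) (by simp)
      (by intros; simp [mul_comm])
    · intro p hp
      simp only [mem_filter, mem_offDiag, mem_univ, true_and, Prod.fst_swap, Prod.snd_swap] at hp ⊢
      exact ⟨hp.1.symm, hp.2.le.not_gt⟩
    · intro p hp
      simp only [mem_filter, mem_offDiag, mem_univ, true_and, Prod.fst_swap, Prod.snd_swap] at hp ⊢
      exact ⟨hp.1.symm, lt_of_le_of_ne (not_lt.1 hp.2) hp.1.symm⟩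
  have h3 := sum_filter_add_sum_filter_not (univ : Finset (Fin n)).offDiag (fun p => p.1 < p.2)
    (fun p => r p.1 * r p.2)
  rw [sum_mul_sum, ← sum_product', ← diag_union_offDiag, sum_union (disjoint_diag_offDiag _),
    sum_diag, ← h3, h1, ← h2]
  ring

lemma sum_edgeDeg_mul (r : Fin n → ℕ) (A : Finset (Sym2 (Fin n))) :
    ∑ v, edgeDeg A v * r v = ∑ e ∈ A, ∑ v, if v ∈ e then r v else 0 := by
  rw [sum_comm]
  refine sum_congr rfl fun v _ => ?_
  rw [edgeDeg, ← sum_filter, sum_const, smul_eq_mul]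

lemma sum_ends_mk (r : Fin n → ℕ) {u v : Fin n} (h : u ≠ v) :
    (∑ w, if w ∈ s(u, v) then r w else 0) = r u + r v := by
  rw [← sum_filter, show (univ.filter fun w => w ∈ s(u, v)) = {u, v} by ext; simp, sum_pair h]

lemma sum_edgeDeg {A : Finset (Sym2 (Fin n))} (hA : A ⊆ allEdges n) :
    ∑ v, edgeDeg A v = 2 * A.card := by
  have h := sum_edgeDeg_mul (fun _ => 1) A
  simp only [mul_one] at h
  rw [h, mul_comm, ← smul_eq_mul, ← sum_const]
  refine sum_congr rfl fun e he => ?_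
  have he' := hA he
  induction e using Sym2.ind with | _ u v =>
  exact sum_ends_mk _ (by simpa [allEdges] using he')

lemma stubCount_eq_zero {d : Fin n → ℕ} {A : Finset (Sym2 (Fin n))}
    (h : ¬ ∀ v, edgeDeg A v ≤ d v) : stubCount d A = 0 := by
  push Not at h
  obtain ⟨v, hv⟩ := h
  exact prod_eq_zero (mem_univ v) (Nat.descFactorial_eq_zero_iff_lt.2 hv)

lemma sum_residual {d : Fin n → ℕ} {A : Finset (Sym2 (Fin n))} (hA : A ⊆ allEdges n)
    (h : ∀ v, edgeDeg A v ≤ d v) : ∑ v, (d v - edgeDeg A v) = ∑ v, d v - 2 * A.card := by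
  rw [← sum_edgeDeg hA, sum_tsub_distrib _ fun v _ => h v]

lemma two_mul_sum_endProd_le (r : Fin n → ℕ) (A : Finset (Sym2 (Fin n))) :
    2 * ∑ e ∈ allEdges n \ A, endProd r e ≤ (∑ v, r v) * (∑ v, r v - 1) := by
  have h1 := two_mul_sum_endProd_add r
  have h2 : ∑ e ∈ allEdges n \ A, endProd r e ≤ ∑ e ∈ allEdges n, endProd r e :=
    sum_le_sum_of_subset sdiff_subset
  have h3 : ∑ v, r v ≤ ∑ v, r v * r v := sum_le_sum fun v _ => Nat.le_mul_self _
  rw [Nat.mul_sub_one]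
  omega

lemma le_two_mul_sum_endProd {r : Fin n → ℕ} {A : Finset (Sym2 (Fin n))} (hA : A ⊆ allEdges n)
    {K : ℕ} (hr : ∀ v, r v ≤ K) (hd : ∀ v, edgeDeg A v ≤ K) :
    (∑ v, r v) * (∑ v, r v) ≤
      2 * ∑ e ∈ allEdges n \ A, endProd r e + (K + K * K) * ∑ v, r v := by
  have h1 := two_mul_sum_endProd_add r
  have h2 := sum_sdiff (f := endProd r) hA
  have h3 : ∑ v, r v * r v ≤ K * ∑ v, r v := by
    rw [mul_sum]
    exact sum_le_sum fun v _ => Nat.mul_le_mul_right _ (hr v)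
  have h4 : 2 * ∑ e ∈ A, endProd r e ≤ K * (K * ∑ v, r v) := by
    calc 2 * ∑ e ∈ A, endProd r e ≤ K * ∑ e ∈ A, ∑ v, (if v ∈ e then r v else 0) := by
          rw [mul_sum, mul_sum]
          refine sum_le_sum fun e he => ?_
          have he' := hA he
          induction e using Sym2.ind with | _ u v =>
          have huv : u ≠ v := by simpa [allEdges] using he'
          rw [endProd_mk r huv, sum_ends_mk r huv]
          nlinarith [Nat.mul_le_mul_right (r v) (hr u), Nat.mul_le_mul_right (r u) (hr v)]
      _ = K * ∑ v, edgeDeg A v * r v := by rw [sum_edgeDeg_mul]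
      _ ≤ K * (K * ∑ v, r v) := by
          rw [mul_sum univ r]
          exact Nat.mul_le_mul_left _ (sum_le_sum fun v _ => Nat.mul_le_mul_right _ (hd v))
  nlinarith

lemma matchingCount_zero (d : Fin n → ℕ) : matchingCount d 0 = 1 := by
  simp [matchingCount, stubCount, edgeDeg]

lemma matchingCount_succ_le (d : Fin n → ℕ) (j : ℕ) :
    2 * ((j + 1) * matchingCount d (j + 1))
      ≤ (∑ v, d v - 2 * j) * (∑ v, d v - 2 * j - 1) * matchingCount d j := by
  rw [succ_mul_matchingCount_succ, matchingCount, mul_sum, mul_sum]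
  refine sum_le_sum fun A hA => ?_
  obtain ⟨hA, hj⟩ := mem_powersetCard.1 hA
  by_cases h : ∀ v, edgeDeg A v ≤ d v
  · have := two_mul_sum_endProd_le (fun v => d v - edgeDeg A v) A
    rw [sum_residual hA h, hj] at this
    nlinarith [Nat.mul_le_mul_left (stubCount d A) this]
  · simp [stubCount_eq_zero h]

/-- The number of simple matchings is at most the number of all matchings. -/
lemma matchingCount_mul_le (d : Fin n → ℕ) (E : ℕ) (hE : ∑ v, d v = 2 * E) :
    matchingCount d E * (2 ^ E * E.factorial) ≤ (2 * E).factorial := by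
  have key : ∀ j ≤ E, matchingCount d j * (2 ^ j * j.factorial) * (2 * E - 2 * j).factorial
      ≤ (2 * E).factorial := by
    intro j
    induction j with
    | zero => simp [matchingCount_zero]
    | succ j ih =>
      intro hj
      refine le_trans ?_ (ih (by omega))
      obtain ⟨k, hk⟩ : ∃ k, 2 * E - 2 * j = k + 2 := ⟨2 * E - 2 * j - 2, by omega⟩
      have h1 := matchingCount_succ_le d j
      rw [hE, hk] at h1
      rw [hk, show 2 * E - 2 * (j + 1) = k by omega, Nat.factorial_succ (k + 1),
        Nat.factorial_succ k, Nat.factorial_succ j, pow_succ]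
      have h2 := Nat.mul_le_mul_right (2 ^ j * j.factorial * k.factorial) h1
      simp only [show k + 2 - 1 = k + 1 by omega] at h2
      nlinarith
  simpa using key E le_rfl

lemma le_matchingCount_succ {d : Fin n → ℕ} {K : ℕ} (hK : ∀ v, d v ≤ K) {j l : ℕ}
    (hl : 2 * j + 2 * l + K + K * K ≤ ∑ v, d v) :
    2 * (l * l) * matchingCount d j ≤ (j + 1) * matchingCount d (j + 1) := by
  rw [succ_mul_matchingCount_succ, matchingCount, mul_sum]
  refine sum_le_sum fun A hA => ?_
  obtain ⟨hA, hj⟩ := mem_powersetCard.1 hA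
  by_cases h : ∀ v, edgeDeg A v ≤ d v
  · have h1 := le_two_mul_sum_endProd (r := fun v => d v - edgeDeg A v) hA (K := K)
      (fun v => (Nat.sub_le _ _).trans (hK v)) (fun v => (h v).trans (hK v))
    rw [sum_residual hA h, hj] at h1
    obtain ⟨S, hS⟩ : ∃ S, ∑ v, d v - 2 * j = 2 * l + (K + K * K) + S :=
      ⟨∑ v, d v - 2 * j - (2 * l + (K + K * K)), by omega⟩
    rw [hS] at h1
    set T := ∑ e ∈ allEdges n \ A, endProd (fun v => d v - edgeDeg A v) e
    have h2 : 2 * (l * l) ≤ T := by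
      set c := K + K * K
      nlinarith [Nat.zero_le (l * c), Nat.zero_le (l * S), Nat.zero_le (S * S),
        Nat.zero_le (S * c)]
    rw [mul_comm]
    exact Nat.mul_le_mul_left _ h2
  · simp [stubCount_eq_zero h]

/-- Bounded degrees allow many simple matchings that leave few half-edges unmatched. -/
lemma le_matchingCount {d : Fin n → ℕ} {K : ℕ} (hK : ∀ v, d v ≤ K) {J : ℕ}
    (hJ : 2 * J + K + K * K ≤ ∑ v, d v) : 2 ^ J * J.factorial ≤ matchingCount d J := by
  have key : ∀ j ≤ J, 2 ^ j * (J.factorial * J.factorial)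
      ≤ matchingCount d j * j.factorial * ((J - j).factorial * (J - j).factorial) := by
    intro j
    induction j with
    | zero => simp [matchingCount_zero]
    | succ j ih =>
      intro hj
      obtain ⟨k, hk⟩ : ∃ k, J - j = k + 1 := ⟨J - j - 1, by omega⟩
      have h1 := le_matchingCount_succ hK (j := j) (l := k + 1) (by omega)
      have h2 := ih (by omega)
      rw [hk, Nat.factorial_succ] at h2
      rw [show J - (j + 1) = k by omega, Nat.factorial_succ, pow_succ]
      have h3 := Nat.mul_le_mul_right (j.factorial * (k.factorial * k.factorial)) h1
      nlinarith
  have h := key J le_rfl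
  simp only [Nat.sub_self, Nat.factorial_zero, mul_one] at h
  refine Nat.le_of_mul_le_mul_right ?_ J.factorial_pos
  rwa [mul_assoc]

end EdgeSets

/-! ### Graph sums as sums over edge sets -/

section GraphSums

open Finset

variable {n : ℕ}

open Classical in
lemma edgeDeg_edgeFinset (G : SimpleGraph (Fin n)) (v : Fin n) :
    edgeDeg G.edgeFinset v = G.degree v := by
  rw [← SimpleGraph.card_incidenceFinset_eq_degree, SimpleGraph.incidenceFinset_eq_filter]
  unfold edgeDeg
  congr!

open Classical in
lemma edgeFinset_mem_powerset (G : SimpleGraph (Fin n)) :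
    G.edgeFinset ∈ (allEdges n).powerset := by
  rw [Finset.mem_powerset]
  intro e he
  rw [allEdges, mem_filter]
  exact ⟨mem_univ _, G.not_isDiag_of_mem_edgeSet (SimpleGraph.mem_edgeFinset.1 he)⟩

lemma edgeFinset_fromEdgeSet {A : Finset (Sym2 (Fin n))} (hA : A ⊆ allEdges n)
    {_ : Fintype (SimpleGraph.fromEdgeSet (A : Set (Sym2 (Fin n)))).edgeSet} :
    (SimpleGraph.fromEdgeSet (A : Set (Sym2 (Fin n)))).edgeFinset = A := by
  ext e
  rw [SimpleGraph.mem_edgeFinset, SimpleGraph.edgeSet_fromEdgeSet]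
  constructor
  · rintro ⟨h, -⟩; exact h
  · intro h
    have := hA h
    rw [allEdges, mem_filter] at this
    exact ⟨h, this.2⟩

open Classical in
lemma sum_graph_eq_sum_edges (ψ : Finset (Sym2 (Fin n)) → ℝ) :
    ∑ G : SimpleGraph (Fin n), ψ G.edgeFinset = ∑ A ∈ (allEdges n).powerset, ψ A := by
  refine sum_bij' (fun G _ => G.edgeFinset) (fun A _ => SimpleGraph.fromEdgeSet (A : Set _))
    (fun G _ => edgeFinset_mem_powerset G) (fun _ _ => mem_univ _) ?_ ?_ (fun _ _ => rfl)
  · intro G _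
    simp
  · intro A hA
    exact edgeFinset_fromEdgeSet (Finset.mem_powerset.1 hA)

lemma edgeDeg_lt {A : Finset (Sym2 (Fin n))} (hA : A ⊆ allEdges n) (v : Fin n) :
    edgeDeg A v < n := by
  classical
  have h := edgeDeg_edgeFinset (SimpleGraph.fromEdgeSet (A : Set _)) v
  rw [edgeFinset_fromEdgeSet hA] at h
  have h2 := (SimpleGraph.fromEdgeSet (A : Set (Sym2 (Fin n)))).degree_lt_card_verts v
  rw [Fintype.card_fin] at h2
  rw [h]
  convert h2

lemma card_allEdges (n : ℕ) : (allEdges n).card = n.choose 2 := by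
  have h := Sym2.card_subtype_not_diag (α := Fin n)
  rw [Fintype.card_subtype, Fintype.card_fin] at h
  exact h

/-- The degree function of a graph. -/
def degrees (G : SimpleGraph (Fin n)) (v : Fin n) : ℕ := by
  classical exact G.degree v

lemma degFreq_eq_card (G : SimpleGraph (Fin n)) (i : ℕ) :
    degFreq G i = (univ.filter fun v => degrees G v = i).card := by
  classical
  unfold degFreq degrees
  congr!

lemma sum_degFreq_mul (G : SimpleGraph (Fin n)) (f : ℕ → ℝ) :
    ∑ i ∈ range n, (degFreq G i : ℝ) * f i = ∑ v, f (degrees G v) := by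
  classical
  have h : ∀ v ∈ (univ : Finset (Fin n)), degrees G v ∈ range n := by
    intro v _
    have := G.degree_lt_card_verts v
    rw [mem_range]
    simpa [degrees] using this
  rw [← sum_fiberwise_of_maps_to h]
  refine sum_congr rfl fun i _ => ?_
  rw [degFreq_eq_card, ← nsmul_eq_mul, ← sum_const]
  exact sum_congr rfl fun v hv => by rw [(mem_filter.1 hv).2]

/-- The unnormalized mass of the graph with edge set `A`. -/
def edgeWeight (β : ℝ) (f : ℕ → ℝ) (A : Finset (Sym2 (Fin n))) : ℝ :=
  (β / n) ^ A.card * (1 - β / n) ^ (n.choose 2 - A.card) * Real.exp (∑ v, f (edgeDeg A v))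

open Classical in
lemma graphWeight_eq_edgeWeight (β : ℝ) (f : ℕ → ℝ) (G : SimpleGraph (Fin n)) :
    graphWeight β f G = edgeWeight β f G.edgeFinset := by
  unfold graphWeight edgeWeight
  rw [sum_degFreq_mul, ← SimpleGraph.coe_edgeFinset, Set.ncard_coe_finset]
  simp only [edgeDeg_edgeFinset]
  rfl

open Classical in
/-- The total mass of the graphs with `E` edges whose degree function lies in `B`. -/
def levelWeight (β : ℝ) (f : ℕ → ℝ) (B : Set (Fin n → ℕ)) (E : ℕ) : ℝ :=
  ∑ A ∈ (allEdges n).powersetCard E with edgeDeg A ∈ B, edgeWeight β f A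

open Classical in
lemma sum_graphWeight (β : ℝ) (f : ℕ → ℝ) (B : Set (Fin n → ℕ)) :
    ∑ G : SimpleGraph (Fin n) with degrees G ∈ B, graphWeight β f G
      = ∑ E ∈ range (n.choose 2 + 1), levelWeight β f B E := by
  have h : ∀ G : SimpleGraph (Fin n), degrees G = edgeDeg G.edgeFinset := fun G => by
    funext v
    rw [edgeDeg_edgeFinset]
    rfl
  rw [sum_filter]
  simp only [h, graphWeight_eq_edgeWeight]
  rw [sum_graph_eq_sum_edges (fun A => if edgeDeg A ∈ B then edgeWeight β f A else 0),
    sum_powerset, card_allEdges]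
  refine sum_congr rfl fun E _ => ?_
  rw [levelWeight, sum_filter]

lemma Z_eq_sum_levelWeight (β : ℝ) (f : ℕ → ℝ) (n : ℕ) :
    Z β f n = ∑ E ∈ range (n.choose 2 + 1), levelWeight β f (Set.univ : Set (Fin n → ℕ)) E := by
  classical
  rw [← sum_graphWeight, Z]
  simp

open Classical in
/-- Chernoff-type bound for the graphs with `E` edges by independent degrees. -/
lemma pow_mul_levelWeight_le {β : ℝ} (hβ : 0 ≤ β) (hn : β ≤ n) (f : ℕ → ℝ)
    (B : Set (Fin n → ℕ)) (E : ℕ) (θ : ℝ≥0) :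
    (θ : ℝ) ^ (2 * E) * levelWeight β f B E ≤
      (β / n) ^ E * (1 - β / n) ^ (n.choose 2 - E)
        * ((2 * E).factorial / (2 ^ E * E.factorial))
        * ∑ d ∈ Fintype.piFinset (fun _ : Fin n => range n) with d ∈ B,
            ∏ v, sigmaWeight f θ (d v) := by
  have hq : 0 ≤ 1 - β / n := by
    rcases Nat.eq_zero_or_pos n with h | h
    · simp [h]
    · rw [sub_nonneg, div_le_one (by exact_mod_cast h)]
      exact hn
  have hc : 0 ≤ (β / n) ^ E * (1 - β / n) ^ (n.choose 2 - E) := by positivity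
  have h1 : (θ : ℝ) ^ (2 * E) * levelWeight β f B E =
      (β / n) ^ E * (1 - β / n) ^ (n.choose 2 - E) *
        ∑ A ∈ (allEdges n).powersetCard E with edgeDeg A ∈ B,
          ∏ v, (((edgeDeg A v).factorial : ℝ) * sigmaWeight f θ (edgeDeg A v)) := by
    rw [levelWeight, mul_sum, mul_sum]
    refine sum_congr rfl fun A hA => ?_
    obtain ⟨hA, hE⟩ := mem_powersetCard.1 (mem_filter.1 hA).1
    have : ∀ v, ((edgeDeg A v).factorial : ℝ) * sigmaWeight f θ (edgeDeg A v)
        = (θ : ℝ) ^ edgeDeg A v * Real.exp (f (edgeDeg A v)) := fun v => by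
      unfold sigmaWeight
      field_simp
    simp only [this, prod_mul_distrib, prod_pow_eq_pow_sum, ← Real.exp_sum, sum_edgeDeg hA, hE,
      edgeWeight]
    ring
  rw [h1, mul_assoc _ ((_ : ℝ) / _)]
  refine mul_le_mul_of_nonneg_left ?_ hc
  have hmaps : ∀ A ∈ ((allEdges n).powersetCard E).filter (fun A => edgeDeg A ∈ B), edgeDeg A ∈
      (Fintype.piFinset (fun _ : Fin n => range n)).filter (· ∈ B) := by
    intro A hA
    rw [mem_filter] at hA ⊢
    exact ⟨Fintype.mem_piFinset.2 fun v => mem_range.2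
      (edgeDeg_lt (mem_powersetCard.1 hA.1).1 v), hA.2⟩
  rw [← sum_fiberwise_of_maps_to hmaps, mul_sum]
  refine sum_le_sum fun d _ => ?_
  have hw : 0 ≤ ∏ v, sigmaWeight f θ (d v) := prod_nonneg fun v _ => sigmaWeight_nonneg _ _ _
  set S := (((allEdges n).powersetCard E).filter fun A => edgeDeg A ∈ B).filter
    fun A => edgeDeg A = d with hS
  have h2 : ∑ A ∈ S, ∏ v, (((edgeDeg A v).factorial : ℝ) * sigmaWeight f θ (edgeDeg A v))
      = (∑ A ∈ S, stubCount d A : ℕ) * ∏ v, sigmaWeight f θ (d v) := by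
    rw [Nat.cast_sum, sum_mul]
    refine sum_congr rfl fun A hA => ?_
    have hd : edgeDeg A = d := (mem_filter.1 hA).2
    rw [stubCount, hd, prod_mul_distrib]
    simp [Nat.descFactorial_self]
  rw [h2]
  refine mul_le_mul_of_nonneg_right ?_ hw
  by_cases hE : S = ∅
  · rw [hE]
    simp
    positivity
  obtain ⟨A, hA⟩ := nonempty_iff_ne_empty.2 hE
  have hA' := mem_filter.1 hA
  have hA'' := mem_powersetCard.1 (mem_filter.1 hA'.1).1
  have hsum : ∑ v, d v = 2 * E := by rw [← hA'.2, sum_edgeDeg hA''.1, hA''.2]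
  have h3 := matchingCount_mul_le d E hsum
  have h4 : ∑ A ∈ S, stubCount d A ≤ matchingCount d E :=
    sum_le_sum_of_subset ((filter_subset _ _).trans (filter_subset _ _))
  rw [le_div_iff₀ (by positivity)]
  exact_mod_cast (Nat.mul_le_mul_right _ h4).trans h3

lemma card_sum_eq_le (T : Finset (Fin n → ℕ)) (R : ℕ) (hT : ∀ r ∈ T, ∑ v, r v = R) :
    T.card ≤ n ^ R := by
  have h := sum_pow_eq_sum_piAntidiag (univ : Finset (Fin n)) (fun _ => (1 : ℕ)) R
  simp only [sum_const, card_univ, Fintype.card_fin, smul_eq_mul, mul_one, one_pow,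
    prod_const_one] at h
  rw [h]
  calc T.card ≤ (piAntidiag (univ : Finset (Fin n)) R).card := card_le_card fun r hr => by
        simp [mem_piAntidiag, hT r hr]
    _ = ∑ _k ∈ piAntidiag (univ : Finset (Fin n)) R, 1 := by simp
    _ ≤ _ := sum_le_sum fun k _ => Nat.multinomial_pos _ _

lemma prod_sigmaWeight_mul_stubCount_le {f : ℕ → ℝ} {θ : ℝ≥0} {K R : ℕ} {M : ℝ}
    (hM1 : 1 ≤ M) (hM : ∀ k d, k ≤ d → d ≤ K → Real.exp (f d) ≤ Real.exp (f k) * M)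
    {d : Fin n → ℕ} (hd : ∀ v, d v ≤ K) {A : Finset (Sym2 (Fin n))}
    (hA : ∀ v, edgeDeg A v ≤ d v) (hR : ∑ v, (d v - edgeDeg A v) = R) :
    (∏ v, sigmaWeight f θ (d v)) * stubCount d A
      ≤ (θ : ℝ) ^ (∑ v, d v) * M ^ R * Real.exp (∑ v, f (edgeDeg A v)) := by
  rw [stubCount, Nat.cast_prod, ← prod_mul_distrib, ← hR, ← prod_pow_eq_pow_sum,
    ← prod_pow_eq_pow_sum, Real.exp_sum, ← prod_mul_distrib, ← prod_mul_distrib]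
  refine prod_le_prod (fun v _ => mul_nonneg (sigmaWeight_nonneg _ _ _) (by positivity))
    fun v _ => ?_
  have h1 : ((d v).descFactorial (edgeDeg A v) : ℝ) ≤ (d v).factorial := by
    have := Nat.factorial_mul_descFactorial (hA v)
    exact_mod_cast this ▸ Nat.le_mul_of_pos_left _ (Nat.factorial_pos _)
  have h2 : Real.exp (f (d v)) ≤ Real.exp (f (edgeDeg A v)) * M ^ (d v - edgeDeg A v) := by
    rcases (hA v).eq_or_lt with h | h
    · simp [h]
    · exact (hM _ _ (hA v) (hd v)).trans
        (mul_le_mul_of_nonneg_left (le_self_pow₀ hM1 (by omega)) (Real.exp_pos _).le)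
  calc sigmaWeight f θ (d v) * ((d v).descFactorial (edgeDeg A v))
      ≤ sigmaWeight f θ (d v) * (d v).factorial :=
        mul_le_mul_of_nonneg_left h1 (sigmaWeight_nonneg _ _ _)
    _ = (θ : ℝ) ^ d v * Real.exp (f (d v)) := by unfold sigmaWeight; field_simp
    _ ≤ (θ : ℝ) ^ d v * (Real.exp (f (edgeDeg A v)) * M ^ (d v - edgeDeg A v)) := by gcongr
    _ = _ := by ring

/-- Lower bound for the number of graphs with `j` edges, by degree functions bounded by `K`. -/
lemma le_sum_exp_edgeDeg {f : ℕ → ℝ} {θ : ℝ≥0} {K R : ℕ} {M : ℝ} (hKR : K + K * K ≤ R)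
    (hM1 : 1 ≤ M) (hM : ∀ k d, k ≤ d → d ≤ K → Real.exp (f d) ≤ Real.exp (f k) * M) (j : ℕ)
    (T : Finset (Fin n → ℕ)) (hT : ∀ d ∈ T, (∀ v, d v ≤ K) ∧ ∑ v, d v = 2 * j + R) :
    2 ^ j * (j.factorial : ℝ) * ∑ d ∈ T, ∏ v, sigmaWeight f θ (d v)
      ≤ (θ : ℝ) ^ (2 * j + R) * (M * n) ^ R *
        ∑ A ∈ (allEdges n).powersetCard j, Real.exp (∑ v, f (edgeDeg A v)) := by
  have h1 : 2 ^ j * (j.factorial : ℝ) * ∑ d ∈ T, ∏ v, sigmaWeight f θ (d v)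
      ≤ ∑ d ∈ T, (∏ v, sigmaWeight f θ (d v)) * matchingCount d j := by
    rw [mul_sum]
    refine sum_le_sum fun d hd => ?_
    rw [mul_comm]
    refine mul_le_mul_of_nonneg_left ?_ (prod_nonneg fun v _ => sigmaWeight_nonneg _ _ _)
    exact_mod_cast le_matchingCount (hT d hd).1 (by rw [(hT d hd).2]; omega)
  refine h1.trans ?_
  simp only [matchingCount, Nat.cast_sum, mul_sum]
  rw [sum_comm]
  refine sum_le_sum fun A hA => ?_
  obtain ⟨hA, hj⟩ := mem_powersetCard.1 hA
  have hzero : ∀ d ∈ T, d ∉ T.filter (fun d => ∀ v, edgeDeg A v ≤ d v) →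
      (∏ v, sigmaWeight f θ (d v)) * (stubCount d A : ℝ) = 0 := by
    intro d hd hd'
    rw [stubCount_eq_zero (fun h => hd' (mem_filter.2 ⟨hd, h⟩))]
    simp
  rw [← sum_subset (filter_subset (fun d => ∀ v, edgeDeg A v ≤ d v) T) hzero]
  set T' := T.filter (fun d => ∀ v, edgeDeg A v ≤ d v) with hT'
  have hres : ∀ d ∈ T', ∑ v, (d v - edgeDeg A v) = R := by
    intro d hd
    obtain ⟨hd, hle⟩ := mem_filter.1 hd
    rw [sum_residual hA hle, (hT d hd).2, hj]
    omega
  have hcard : T'.card ≤ n ^ R := by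
    have hinj : Set.InjOn (fun (d : Fin n → ℕ) v => d v - edgeDeg A v) T' := by
      intro d hd d' hd' h
      funext v
      have h1 := (mem_filter.1 hd).2 v
      have h2 := (mem_filter.1 hd').2 v
      have h3 := congrFun h v
      simp only at h3
      omega
    rw [← card_image_of_injOn hinj]
    refine card_sum_eq_le _ R fun r hr => ?_
    obtain ⟨d, hd, rfl⟩ := mem_image.1 hr
    exact hres d hd
  have hcard' : (T'.card : ℝ) ≤ (n : ℝ) ^ R := by exact_mod_cast hcard
  calc ∑ d ∈ T', (∏ v, sigmaWeight f θ (d v)) * (stubCount d A : ℝ)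
      ≤ ∑ _d ∈ T', (θ : ℝ) ^ (2 * j + R) * M ^ R * Real.exp (∑ v, f (edgeDeg A v)) := by
        refine sum_le_sum fun d hd => ?_
        obtain ⟨hd', hle⟩ := mem_filter.1 hd
        have := prod_sigmaWeight_mul_stubCount_le (θ := θ) hM1 hM (hT d hd').1 hle (hres d hd)
        rwa [(hT d hd').2] at this
    _ = T'.card * ((θ : ℝ) ^ (2 * j + R) * M ^ R * Real.exp (∑ v, f (edgeDeg A v))) := by
        rw [sum_const, nsmul_eq_mul]
    _ ≤ (n : ℝ) ^ R * ((θ : ℝ) ^ (2 * j + R) * M ^ R * Real.exp (∑ v, f (edgeDeg A v))) := by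
        gcongr
    _ = _ := by rw [mul_pow]; ring

end GraphSums

/-! ### The Gibbs inequality -/

section Gibbs

variable {F : ℕ → ℝ}

lemma mass_sigma (hF : LinearGrowth F) (θ : ℝ≥0) (i : ℕ) :
    (sigma F hF θ).mass i = Real.exp (-logPartition F θ) * sigmaWeight F θ i :=
  FinMean.mass_ofMass _ _ _ _ _

lemma sigmaWeight_pos (F : ℕ → ℝ) {θ : ℝ≥0} {i : ℕ} (h : θ ≠ 0 ∨ i = 0) :
    0 < sigmaWeight F θ i := by
  have : 0 < (θ : ℝ) ^ i := by
    rcases h with h | h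
    · have : 0 < θ := pos_iff_ne_zero.2 h
      positivity
    · simp [h]
  unfold sigmaWeight
  positivity

lemma log_mass_sigma (hF : LinearGrowth F) {θ : ℝ≥0} {i : ℕ} (h : θ ≠ 0 ∨ i = 0) :
    Real.log ((sigma F hF θ).mass i)
      = -logPartition F θ + (i * Real.log θ + F i - Real.log i.factorial) := by
  have hθ : (θ : ℝ) ^ i ≠ 0 := by
    rcases h with h | h
    · exact pow_ne_zero _ (by exact_mod_cast h)
    · simp [h]
  rw [mass_sigma, Real.log_mul (Real.exp_pos _).ne' (sigmaWeight_pos F h).ne', Real.log_exp,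
    sigmaWeight, Real.log_div (mul_ne_zero hθ (Real.exp_pos _).ne') (by positivity),
    Real.log_mul hθ (Real.exp_pos _).ne', Real.log_exp, Real.log_pow]

lemma summable_mass_mul (hF : LinearGrowth F) (μ : FinMean) :
    Summable fun i => μ.mass i * F i := by
  obtain ⟨C, hC, hb⟩ := (linearGrowth_iff F).1 hF
  refine Summable.of_norm_bounded ((μ.summable_mean.add μ.hasSum_mass.summable).mul_left C)
    fun i => ?_
  rw [Real.norm_eq_abs, abs_mul, abs_of_nonneg (μ.mass_nonneg i)]
  nlinarith [mul_le_mul_of_nonneg_left (hb i) (μ.mass_nonneg i)]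

lemma mass_mul_log_sub_ge {x s : ℝ} (hx : 0 ≤ x) (hs : 0 ≤ s) (h : x ≠ 0 → 0 < s) :
    x - s ≤ x * (Real.log x - Real.log s) ∧ (x * (Real.log x - Real.log s) = x - s → x = s) := by
  rcases hx.eq_or_lt with h0 | h0
  · rw [← h0]
    simp only [zero_mul, zero_sub, Left.neg_nonpos_iff]
    exact ⟨hs, fun h => by linarith⟩
  · have hs' := h h0.ne'
    have hl : Real.log x - Real.log s = -Real.log (s / x) := by
      rw [Real.log_div hs'.ne' h0.ne']; ring
    have hxs : x * (s / x) = s := by field_simp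
    rw [hl]
    constructor
    · nlinarith [mul_le_mul_of_nonneg_left (Real.log_le_sub_one_of_pos (div_pos hs' h0)) h0.le]
    · intro heq
      by_contra hne
      have hlt := Real.log_lt_sub_one_of_pos (div_pos hs' h0)
        (fun h1 => hne (by rw [h1] at hxs; linarith))
      nlinarith [mul_lt_mul_of_pos_left hlt h0]

/-- The Gibbs inequality relative to `σ_θ`. -/
lemma gibbs_inequality (hF : LinearGrowth F) (μ : FinMean) (θ : ℝ≥0)
    (h0 : θ = 0 → ∀ i, i ≠ 0 → μ.mass i = 0)
    (hs : Summable fun i : ℕ => μ.mass i * Real.log (i.factorial * μ.mass i)) :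
    μ.mean * Real.log θ - logPartition F θ + μ.expect F
        ≤ ∑' i : ℕ, μ.mass i * Real.log (i.factorial * μ.mass i) ∧
      (∑' i : ℕ, μ.mass i * Real.log (i.factorial * μ.mass i)
        = μ.mean * Real.log θ - logPartition F θ + μ.expect F → μ = sigma F hF θ) := by
  set σ := sigma F hF θ with hσ
  have hpos : ∀ i, μ.mass i ≠ 0 → (θ ≠ 0 ∨ i = 0) := fun i hi => by
    by_contra hc
    push Not at hc
    exact hi (h0 hc.1 i hc.2)
  have hσpos : ∀ i, μ.mass i ≠ 0 → 0 < σ.mass i := fun i hi => by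
    rw [hσ, mass_sigma]
    exact mul_pos (Real.exp_pos _) (sigmaWeight_pos F (hpos i hi))
  have hterm : ∀ i, μ.mass i * (Real.log (μ.mass i) - Real.log (σ.mass i))
      = μ.mass i * Real.log (i.factorial * μ.mass i) - μ.mass i * F i
        - (i * μ.mass i) * Real.log θ + μ.mass i * logPartition F θ := fun i => by
    by_cases hi : μ.mass i = 0
    · simp [hi]
    · rw [hσ, log_mass_sigma hF (hpos i hi), Real.log_mul (by positivity) hi]
      ring
  have hsum : HasSum (fun i => μ.mass i * (Real.log (μ.mass i) - Real.log (σ.mass i))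
      - (μ.mass i - σ.mass i))
      ((∑' i : ℕ, μ.mass i * Real.log (i.factorial * μ.mass i)) - μ.expect F
        - μ.mean * Real.log θ + 1 * logPartition F θ - (1 - 1)) := by
    simp only [hterm]
    exact (((hs.hasSum.sub (summable_mass_mul hF μ).hasSum).sub
      (μ.summable_mean.hasSum.mul_right _)).add (μ.hasSum_mass.mul_right _)).sub
      (μ.hasSum_mass.sub σ.hasSum_mass)
  have hnn : ∀ i, 0 ≤ μ.mass i * (Real.log (μ.mass i) - Real.log (σ.mass i))
      - (μ.mass i - σ.mass i) := fun i =>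
    sub_nonneg.2 (mass_mul_log_sub_ge (μ.mass_nonneg i) (σ.mass_nonneg i) (hσpos i)).1
  refine ⟨by linarith [hsum.nonneg hnn], fun heq => ?_⟩
  rw [heq, show μ.mean * Real.log θ - logPartition F θ + μ.expect F - μ.expect F
    - μ.mean * Real.log θ + 1 * logPartition F θ - (1 - 1) = 0 by ring] at hsum
  have hz := (hasSum_zero_iff_of_nonneg hnn).1 hsum
  refine FinMean.ext_mass fun i => ?_
  have := congrFun hz i
  exact (mass_mul_log_sub_ge (μ.mass_nonneg i) (σ.mass_nonneg i) (hσpos i)).2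
    (by simpa [sub_eq_zero] using this)

lemma hasSum_entropy_sigma (hF : LinearGrowth F) (θ : ℝ≥0) :
    HasSum (fun i : ℕ => (sigma F hF θ).mass i * Real.log (i.factorial * (sigma F hF θ).mass i))
      ((sigma F hF θ).mean * Real.log θ - logPartition F θ + (sigma F hF θ).expect F) := by
  set σ := sigma F hF θ with hσ
  have h := ((σ.summable_mean.hasSum.mul_right (Real.log θ)).sub
    (σ.hasSum_mass.mul_right (logPartition F θ))).add (summable_mass_mul hF σ).hasSum
  rw [one_mul] at h
  refine h.congr_fun (fun i => ?_)
  by_cases hi : θ ≠ 0 ∨ i = 0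
  · have hp : 0 < σ.mass i := by
      rw [hσ, mass_sigma]
      exact mul_pos (Real.exp_pos _) (sigmaWeight_pos F hi)
    rw [Real.log_mul (by positivity) hp.ne', hσ, log_mass_sigma hF hi]
    ring
  · push Not at hi
    have : σ.mass i = 0 := by
      rw [hσ, mass_sigma, sigmaWeight, hi.1]
      simp [hi.2]
    simp [this]

lemma rate_sigma_sub (β : ℝ) (hF : LinearGrowth F) (θ : ℝ≥0) :
    rate β (sigma F hF θ) - (((sigma F hF θ).expect F : ℝ) : EReal) = (H β F hF θ : ℝ) := by
  have h := hasSum_entropy_sigma hF θ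
  rw [rate, if_pos h.summable, h.tsum_eq, H, ← EReal.coe_sub]
  congr 1
  ring

lemma mean_mul_log_sub_le (hF : LinearGrowth F) (θ t : ℝ≥0) (ht : t ≠ 0) :
    (sigma F hF θ).mean * Real.log t - logPartition F t
      ≤ (sigma F hF θ).mean * Real.log θ - logPartition F θ := by
  have h := hasSum_entropy_sigma hF θ
  have := (gibbs_inequality hF (sigma F hF θ) t (fun h => absurd h ht) h.summable).1
  rw [h.tsum_eq] at this
  linarith

end Gibbs

/-! ### The partition function as a power series -/

section Analytic

/-- The power series `∑ e^{F(i)} x^i / i!`. -/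
def partition (F : ℕ → ℝ) (x : ℝ) : ℝ := ∑' i : ℕ, Real.exp (F i) / i.factorial * x ^ i

variable {F : ℕ → ℝ}

lemma analyticOnNhd_tsum_pow {a : ℕ → ℝ}
    (h : ∀ r : ℝ≥0, Summable fun i => ‖a i‖ * (r : ℝ) ^ i) :
    AnalyticOnNhd ℝ (fun x : ℝ => ∑' i, a i * x ^ i) Set.univ := by
  have hr : (FormalMultilinearSeries.ofScalars ℝ a).radius = ⊤ :=
    FormalMultilinearSeries.radius_eq_top_of_summable_norm _ fun r => by
      simpa [FormalMultilinearSeries.ofScalars_norm] using h r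
  have hp := (FormalMultilinearSeries.ofScalars ℝ a).hasFPowerSeriesOnBall (by simp [hr])
  have ha := hp.analyticOnNhd
  rw [hr, Metric.eball_top] at ha
  refine ha.congr isOpen_univ fun x _ => ?_
  change (FormalMultilinearSeries.ofScalarsSum a x) = _
  rw [FormalMultilinearSeries.ofScalarsSum_eq_tsum]
  simp

lemma sigmaWeight_eq (F : ℕ → ℝ) (θ : ℝ≥0) (i : ℕ) :
    sigmaWeight F θ i = Real.exp (F i) / i.factorial * (θ : ℝ) ^ i := by
  unfold sigmaWeight; ring

lemma analyticOnNhd_partition (hF : LinearGrowth F) :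
    AnalyticOnNhd ℝ (partition F) Set.univ := by
  refine analyticOnNhd_tsum_pow fun r => (summable_sigmaWeight hF r).congr fun i => ?_
  rw [sigmaWeight_eq, Real.norm_of_nonneg (by positivity)]

lemma continuous_partition (hF : LinearGrowth F) : Continuous (partition F) :=
  continuous_iff_continuousAt.2 fun x => (analyticOnNhd_partition hF x trivial).continuousAt

lemma tsum_sigmaWeight_eq (F : ℕ → ℝ) (θ : ℝ≥0) : ∑' i, sigmaWeight F θ i = partition F θ := by
  simp only [sigmaWeight_eq, partition]

lemma partition_pos (hF : LinearGrowth F) {x : ℝ} (hx : 0 ≤ x) : 0 < partition F x := by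
  lift x to ℝ≥0 using hx
  rw [← tsum_sigmaWeight_eq]
  exact tsum_sigmaWeight_pos hF x

lemma linearGrowth_succ (hF : LinearGrowth F) : LinearGrowth fun i => F (i + 1) := by
  obtain ⟨C, hC, hb⟩ := (linearGrowth_iff F).1 hF
  refine (linearGrowth_iff _).2 ⟨2 * C, by positivity, fun i => (hb (i + 1)).trans ?_⟩
  push_cast
  have : (0 : ℝ) ≤ i := by positivity
  nlinarith

/-- The mean of `σ_θ`, as a function of a real variable. -/
def meanFun (F : ℕ → ℝ) (x : ℝ) : ℝ := x * (partition (fun i => F (i + 1)) x / partition F x)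

lemma mean_sigma (hF : LinearGrowth F) (θ : ℝ≥0) : (sigma F hF θ).mean = meanFun F θ := by
  have h1 : ∀ i : ℕ, ((i + 1 : ℕ) : ℝ) * (sigma F hF θ).mass (i + 1)
      = Real.exp (-logPartition F θ) * (θ * sigmaWeight (fun i => F (i + 1)) θ i) := fun i => by
    rw [mass_sigma]
    unfold sigmaWeight
    rw [Nat.factorial_succ]
    push_cast
    field_simp
    ring
  rw [FinMean.mean, (sigma F hF θ).summable_mean.tsum_eq_zero_add]
  simp only [h1, tsum_mul_left, tsum_sigmaWeight_eq]
  rw [logPartition, tsum_sigmaWeight_eq, Real.exp_neg, Real.exp_log (partition_pos hF θ.coe_nonneg),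
    meanFun]
  simp
  field_simp

/-- `H` as a function of a real variable. -/
def HFun (β : ℝ) (F : ℕ → ℝ) (x : ℝ) : ℝ :=
  meanFun F x * Real.log x - Real.log (partition F x)
    - meanFun F x / 2 * Real.log (meanFun F x * β) + (meanFun F x + β) / 2

lemma H_eq_HFun (β : ℝ) (hF : LinearGrowth F) (θ : ℝ≥0) : H β F hF θ = HFun β F θ := by
  rw [H, HFun, mean_sigma, logPartition, tsum_sigmaWeight_eq]

lemma meanFun_pos (hF : LinearGrowth F) {x : ℝ} (hx : 0 < x) : 0 < meanFun F x :=
  mul_pos hx (div_pos (partition_pos (linearGrowth_succ hF) hx.le) (partition_pos hF hx.le))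

lemma continuous_meanFun (hF : LinearGrowth F) : Continuous fun θ : ℝ≥0 => meanFun F θ := by
  unfold meanFun
  exact NNReal.continuous_coe.mul
    (((continuous_partition (linearGrowth_succ hF)).comp NNReal.continuous_coe).div
      ((continuous_partition hF).comp NNReal.continuous_coe) fun θ => (partition_pos hF θ.2).ne')

lemma continuous_logPartition (hF : LinearGrowth F) : Continuous (logPartition F) := by
  unfold logPartition
  simp only [tsum_sigmaWeight_eq]
  exact ((continuous_partition hF).comp NNReal.continuous_coe).log
    fun θ => (partition_pos hF θ.2).ne'

lemma continuous_half_mul_log {β : ℝ} (hβ : 0 < β) :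
    Continuous fun x : ℝ => x / 2 * Real.log (x * β) := by
  have h : Continuous fun x : ℝ => (1 / (2 * β)) * ((x * β) * Real.log (x * β)) :=
    continuous_const.mul (Real.continuous_mul_log.comp (continuous_id.mul continuous_const))
  convert h using 2 with x
  field_simp

lemma continuous_H {β : ℝ} (hβ : 0 < β) (hF : LinearGrowth F) : Continuous (H β F hF) := by
  have hm := continuous_meanFun hF
  have h1 : Continuous fun θ : ℝ≥0 => meanFun F θ * Real.log θ := by
    have h : Continuous fun θ : ℝ≥0 => ((θ : ℝ) * Real.log θ) *
        (partition (fun i => F (i + 1)) θ / partition F θ) :=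
      (Real.continuous_mul_log.comp NNReal.continuous_coe).mul
        (((continuous_partition (linearGrowth_succ hF)).comp NNReal.continuous_coe).div
          ((continuous_partition hF).comp NNReal.continuous_coe)
          fun θ => (partition_pos hF θ.2).ne')
    convert h using 2 with θ
    rw [meanFun]
    ring
  have h2 := (continuous_half_mul_log hβ).comp hm
  have h3 : H β F hF = fun θ : ℝ≥0 => meanFun F θ * Real.log θ - logPartition F θ
      - meanFun F θ / 2 * Real.log (meanFun F θ * β) + (meanFun F θ + β) / 2 := by
    funext θ
    rw [H, mean_sigma]
  rw [h3]
  exact ((h1.sub (continuous_logPartition hF)).sub h2).add ((hm.add continuous_const).div_const _)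

lemma analyticOnNhd_HFun {β : ℝ} (hβ : 0 < β) (hF : LinearGrowth F) :
    AnalyticOnNhd ℝ (HFun β F) (Set.Ioi 0) := by
  have hP : AnalyticOnNhd ℝ (partition F) (Set.Ioi 0) :=
    (analyticOnNhd_partition hF).mono (Set.subset_univ _)
  have hQ : AnalyticOnNhd ℝ (partition fun i => F (i + 1)) (Set.Ioi 0) :=
    (analyticOnNhd_partition (linearGrowth_succ hF)).mono (Set.subset_univ _)
  have hm : AnalyticOnNhd ℝ (meanFun F) (Set.Ioi 0) :=
    analyticOnNhd_id.mul (hQ.div hP fun x hx => (partition_pos hF (le_of_lt hx)).ne')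
  have hl : AnalyticOnNhd ℝ Real.log (Set.Ioi 0) := fun x hx => analyticAt_log hx
  have hlm : AnalyticOnNhd ℝ (fun x => Real.log (meanFun F x * β)) (Set.Ioi 0) := fun x hx =>
    ((hm x hx).mul analyticAt_const).log (mul_pos (meanFun_pos hF hx) hβ)
  have hlp : AnalyticOnNhd ℝ (fun x => Real.log (partition F x)) (Set.Ioi 0) := fun x hx =>
    (hP x hx).log (partition_pos hF (le_of_lt hx))
  have h2 : AnalyticOnNhd ℝ (fun _ : ℝ => (2 : ℝ)) (Set.Ioi 0) := analyticOnNhd_const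
  exact (((hm.mul hl).sub hlp).sub ((hm.div h2 fun _ _ => two_ne_zero).mul hlm)).add
    ((hm.add analyticOnNhd_const).div h2 fun _ _ => two_ne_zero)

end Analytic

/-! ### The minimizers of `H` -/

section Minimizers

variable {F : ℕ → ℝ}

lemma exists_logPartition_le (hF : LinearGrowth F) :
    ∃ a : ℝ, 1 ≤ a ∧ ∀ θ : ℝ≥0, logPartition F θ ≤ Real.log a + a * θ := by
  obtain ⟨C, hC, hb⟩ := (linearGrowth_iff F).1 hF
  refine ⟨Real.exp C, Real.one_le_exp hC, fun θ => ?_⟩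
  have hs := (NormedSpace.expSeries_div_hasSum_exp (Real.exp C * θ)).mul_left (Real.exp C)
  rw [← Real.exp_eq_exp_ℝ] at hs
  rw [logPartition, Real.log_le_iff_le_exp (tsum_sigmaWeight_pos hF θ), Real.exp_add,
    Real.exp_log (Real.exp_pos _), ← hs.tsum_eq]
  refine (summable_sigmaWeight hF θ).tsum_le_tsum (fun i => ?_) hs.summable
  have h2 : Real.exp (F i) ≤ Real.exp C ^ i * Real.exp C := by
    rw [← Real.exp_nat_mul, ← Real.exp_add]
    apply Real.exp_le_exp.2
    linarith [le_abs_self (F i), hb i]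
  calc sigmaWeight F θ i ≤ (θ : ℝ) ^ i * (Real.exp C ^ i * Real.exp C) / i.factorial := by
        unfold sigmaWeight; gcongr
    _ = _ := by rw [mul_pow]; ring

lemma mean_nonneg (μ : FinMean) : 0 ≤ μ.mean :=
  tsum_nonneg fun i => mul_nonneg (Nat.cast_nonneg _) (μ.mass_nonneg i)

/-- `H` grows faster than any multiple of the mean. -/
lemma exists_mean_sub_le_H {β : ℝ} (hβ : 0 < β) (hF : LinearGrowth F) (A : ℝ) :
    ∃ B, ∀ θ, A * (sigma F hF θ).mean - B ≤ H β F hF θ := by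
  obtain ⟨a, ha, hle⟩ := exists_logPartition_le hF
  set A' := A + a + Real.log β / 2 with hA'
  refine ⟨max (logPartition F 1) (Real.log a + Real.exp (2 * A')), fun θ => ?_⟩
  set m := (sigma F hF θ).mean with hm
  have hm0 : 0 ≤ m := mean_nonneg _
  rcases hm0.eq_or_lt with h0 | h0
  · have h := mean_mul_log_sub_le hF θ 1 one_ne_zero
    rw [← hm, ← h0] at h
    rw [H, ← hm, ← h0]
    simp only [zero_mul, zero_sub, mul_zero, zero_div, zero_add, sub_zero] at h ⊢
    linarith [le_max_left (logPartition F 1) (Real.log a + Real.exp (2 * A'))]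
  · obtain ⟨t, ht⟩ : ∃ t : ℝ≥0, (t : ℝ) = m := ⟨⟨m, hm0⟩, rfl⟩
    have h := mean_mul_log_sub_le hF θ t (fun h => h0.ne (by rw [← ht, h]; rfl))
    have hl := hle t
    rw [← hm, ht] at h
    rw [ht] at hl
    rw [H, ← hm, Real.log_mul h0.ne' hβ.ne']
    have hlog : 2 * A' * m + m - Real.exp (2 * A') ≤ m * Real.log m := by
      have h1 := Real.log_le_sub_one_of_pos (div_pos (Real.exp_pos (2 * A')) h0)
      rw [Real.log_div (Real.exp_pos _).ne' h0.ne', Real.log_exp] at h1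
      have h2 := mul_le_mul_of_nonneg_left h1 h0.le
      have h3 : m * (Real.exp (2 * A') / m - 1) = Real.exp (2 * A') - m := by field_simp
      rw [h3] at h2
      linarith
    have hmx := le_max_right (logPartition F 1) (Real.log a + Real.exp (2 * A'))
    have hexp := Real.exp_pos (2 * A')
    have : m * A' = m * A + m * a + m * Real.log β / 2 := by rw [hA']; ring
    nlinarith

lemma exists_le_mean (hF : LinearGrowth F) (N : ℕ) :
    ∃ M : ℝ≥0, ∀ θ, M ≤ θ → (N : ℝ) ≤ (sigma F hF θ).mean := by
  set c := F (N + 1) - Real.log (N + 1).factorial - logPartition F 1 with hc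
  refine ⟨⟨Real.exp (|c| + 1), (Real.exp_pos _).le⟩, fun θ hθ => ?_⟩
  have hθ' : Real.exp (|c| + 1) ≤ (θ : ℝ) := hθ
  have hθ0 : 0 < (θ : ℝ) := (Real.exp_pos _).trans_le hθ'
  have hlog : |c| + 1 ≤ Real.log θ := by rwa [Real.le_log_iff_exp_le hθ0]
  have h1 := mean_mul_log_sub_le hF θ 1 one_ne_zero
  have h2 : Real.log (sigmaWeight F θ (N + 1)) ≤ logPartition F θ :=
    Real.log_le_log (sigmaWeight_pos F (Or.inl (by exact_mod_cast hθ0.ne')))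
      ((summable_sigmaWeight hF θ).le_tsum _ fun i _ => sigmaWeight_nonneg _ _ _)
  rw [sigmaWeight, Real.log_div (by positivity) (by positivity), Real.log_mul (by positivity)
    (Real.exp_pos _).ne', Real.log_exp, Real.log_pow] at h2
  simp only [NNReal.coe_one, Real.log_one, mul_zero, zero_sub] at h1
  push_cast at h2
  by_contra! hlt
  have := neg_abs_le c
  nlinarith [mul_pos (sub_pos.2 hlt) (show 0 < Real.log θ by linarith [abs_nonneg c])]

lemma continuous_mean_sigma (hF : LinearGrowth F) :
    Continuous fun θ : ℝ≥0 => (sigma F hF θ).mean := by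
  simp only [mean_sigma]
  exact continuous_meanFun hF

lemma mean_sigma_zero (hF : LinearGrowth F) : (sigma F hF 0).mean = 0 := by
  rw [mean_sigma, meanFun]
  simp

lemma mean_sigma_pos (hF : LinearGrowth F) {θ : ℝ≥0} (hθ : θ ≠ 0) : 0 < (sigma F hF θ).mean := by
  rw [mean_sigma]
  exact meanFun_pos hF (by exact_mod_cast pos_iff_ne_zero.2 hθ)

lemma exists_mean_sigma_eq (hF : LinearGrowth F) {x : ℝ} (hx : 0 ≤ x) :
    ∃ θ, (sigma F hF θ).mean = x := by
  obtain ⟨N, hN⟩ := exists_nat_ge x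
  obtain ⟨M, hM⟩ := exists_le_mean hF N
  have := mem_range_of_exists_le_of_exists_ge (continuous_mean_sigma hF)
    ⟨0, (mean_sigma_zero hF).trans_le hx⟩ ⟨M, hN.trans (hM M le_rfl)⟩
  exact this

lemma exists_le_H {β : ℝ} (hβ : 0 < β) (hF : LinearGrowth F) (b : ℝ) :
    ∃ M : ℝ≥0, ∀ θ, M ≤ θ → b ≤ H β F hF θ := by
  obtain ⟨B, hB⟩ := exists_mean_sub_le_H hβ hF 1
  obtain ⟨N, hN⟩ := exists_nat_ge (b + B)
  obtain ⟨M, hM⟩ := exists_le_mean hF N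
  exact ⟨M, fun θ hθ => by linarith [hB θ, hM θ hθ]⟩

lemma logPartition_mono (hF : LinearGrowth F) : Monotone (logPartition F) := fun θ t h => by
  refine Real.log_le_log (tsum_sigmaWeight_pos hF θ)
    ((summable_sigmaWeight hF θ).tsum_le_tsum (fun i => ?_) (summable_sigmaWeight hF t))
  unfold sigmaWeight
  gcongr

lemma exists_H_lt_H_zero {β : ℝ} (hβ : 0 < β) (hF : LinearGrowth F) :
    ∃ θ, H β F hF θ < H β F hF 0 := by
  have hQ := partition_pos (linearGrowth_succ hF) (le_refl 0)
  have hP := partition_pos hF (le_refl 0)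
  have hcont : Continuous fun θ : ℝ≥0 => partition (fun i => F (i + 1)) θ / partition F θ * β
      - Real.exp 1 * θ :=
    ((((continuous_partition (linearGrowth_succ hF)).comp NNReal.continuous_coe).div
      ((continuous_partition hF).comp NNReal.continuous_coe) fun θ =>
        (partition_pos hF θ.2).ne').mul continuous_const).sub
      (continuous_const.mul NNReal.continuous_coe)
  have hev : ∀ᶠ θ : ℝ≥0 in 𝓝 0, 0 < partition (fun i => F (i + 1)) θ / partition F θ * β
      - Real.exp 1 * θ := by
    refine hcont.continuousAt.eventually (lt_mem_nhds ?_)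
    simp only [NNReal.coe_zero, mul_zero, sub_zero]
    positivity
  have hev' : ∀ᶠ θ : ℝ≥0 in 𝓝[>] 0, 0 < partition (fun i => F (i + 1)) θ / partition F θ * β
      - Real.exp 1 * θ := hev.filter_mono nhdsWithin_le_nhds
  obtain ⟨θ, hθ, hpos⟩ := (hev'.and self_mem_nhdsWithin).exists
  have hpos : 0 < θ := hpos
  refine ⟨θ, ?_⟩
  have hm := mean_sigma_pos hF hpos.ne'
  have hθ0 : (0 : ℝ) < θ := by exact_mod_cast hpos
  have hlt : Real.exp 1 * (θ : ℝ) ^ 2 < (sigma F hF θ).mean * β := by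
    rw [mean_sigma, meanFun]
    nlinarith
  have hlog := Real.log_lt_log (by positivity) hlt
  rw [Real.log_mul (by positivity) (by positivity), Real.log_exp, Real.log_pow] at hlog
  rw [H, H, mean_sigma_zero]
  push_cast at hlog
  have := logPartition_mono hF hpos.le
  simp only [zero_mul, zero_sub, zero_div, sub_zero, zero_add]
  nlinarith [mul_lt_mul_of_pos_left hlog hm]

lemma exists_minimizer_on_closed {β : ℝ} (hβ : 0 < β) (hF : LinearGrowth F) {D : Set ℝ≥0}
    (hD : IsClosed D) (hne : D.Nonempty) : ∃ θ ∈ D, ∀ t ∈ D, H β F hF θ ≤ H β F hF t := by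
  obtain ⟨t₀, ht₀⟩ := hne
  obtain ⟨M, hM⟩ := exists_le_H hβ hF (H β F hF t₀)
  have hcomp : IsCompact (Set.Icc 0 (max M t₀) ∩ D) := isCompact_Icc.inter_right hD
  obtain ⟨θ, hθ, hmin⟩ := hcomp.exists_isMinOn ⟨t₀, ⟨zero_le, le_max_right _ _⟩, ht₀⟩
    (continuous_H hβ hF).continuousOn
  refine ⟨θ, hθ.2, fun t ht => ?_⟩
  by_cases h : t ≤ max M t₀
  · exact hmin ⟨⟨zero_le, h⟩, ht⟩
  · exact (hmin ⟨⟨zero_le, le_max_right _ _⟩, ht₀⟩ : H β F hF θ ≤ H β F hF t₀).trans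
      (hM t ((le_max_left _ _).trans (not_le.1 h).le))

lemma finite_minimizers {β : ℝ} (hβ : 0 < β) (hF : LinearGrowth F) {b : ℝ}
    (hb : ∀ θ, b ≤ H β F hF θ) : {θ | H β F hF θ = b}.Finite := by
  by_contra hinf
  have hinf : {θ | H β F hF θ = b}.Infinite := hinf
  obtain ⟨M, hM⟩ := exists_le_H hβ hF (b + 1)
  have hsub : {θ | H β F hF θ = b} ⊆ Set.Icc 0 M := fun θ hθ => ⟨zero_le, by
    by_contra hlt
    have := hM θ (not_le.1 hlt).le
    have hθ : H β F hF θ = b := hθ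
    linarith⟩
  obtain ⟨t, -, ht⟩ := hinf.exists_accPt_of_subset_isCompact isCompact_Icc hsub
  rw [accPt_iff_frequently] at ht
  have htb : H β F hF t = b := by
    have hcl : IsClosed {θ | H β F hF θ = b} :=
      isClosed_eq (continuous_H hβ hF) continuous_const
    exact hcl.closure_subset (mem_closure_iff_frequently.2 (ht.mono fun _ h => h.2))
  have ht0 : t ≠ 0 := by
    rintro rfl
    obtain ⟨θ, hθ⟩ := exists_H_lt_H_zero hβ hF
    linarith [hb θ]
  have htpos : (0 : ℝ) < t := by exact_mod_cast pos_iff_ne_zero.2 ht0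
  have hfreq : ∃ᶠ x in 𝓝[≠] (t : ℝ), HFun β F x = (fun _ => b) x := by
    rw [frequently_nhdsWithin_iff]
    have h2 : ∃ᶠ θ : ℝ≥0 in 𝓝 t, HFun β F θ = b ∧ (θ : ℝ) ∈ ({(t : ℝ)}ᶜ : Set ℝ) :=
      ht.mono fun θ h => ⟨(H_eq_HFun β hF θ) ▸ h.2, by simpa using h.1⟩
    exact (NNReal.continuous_coe.tendsto t).frequently h2
  have heq := (analyticOnNhd_HFun hβ hF).eqOn_of_preconnected_of_frequently_eq
    analyticOnNhd_const isPreconnected_Ioi htpos hfreq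
  have h1 := hM (M + 1) (by simp)
  rw [H_eq_HFun, heq (show (0 : ℝ) < ((M + 1 : ℝ≥0) : ℝ) by positivity)] at h1
  linarith

/-- A measure with the same mean as `σ_θ` has larger free energy, unless it is `σ_θ`. -/
lemma expect_sub_rate_le (β : ℝ) (hF : LinearGrowth F) {μ : FinMean} {θ : ℝ≥0}
    (h : (sigma F hF θ).mean = μ.mean) :
    ((μ.expect F : ℝ) : EReal) - rate β μ ≤ ((-H β F hF θ : ℝ) : EReal) ∧
      (((μ.expect F : ℝ) : EReal) - rate β μ = ((-H β F hF θ : ℝ) : EReal) →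
        μ = sigma F hF θ) := by
  rw [rate]
  split_ifs with hs
  · have h0 : θ = 0 → ∀ i, i ≠ 0 → μ.mass i = 0 := by
      rintro rfl i hi
      rw [mean_sigma_zero] at h
      have hz := (hasSum_zero_iff_of_nonneg fun i => mul_nonneg (Nat.cast_nonneg _)
        (μ.mass_nonneg i)).1 (by rw [h]; exact μ.summable_mean.hasSum)
      have := congrFun hz i
      simpa [hi] using this
    obtain ⟨h1, h2⟩ := gibbs_inequality hF μ θ h0 hs
    rw [← EReal.coe_sub, EReal.coe_le_coe_iff, EReal.coe_eq_coe_iff, H, h]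
    exact ⟨by linarith, fun heq => h2 (by linarith)⟩
  · rw [EReal.sub_top]
    exact ⟨bot_le, fun heq => absurd heq (EReal.bot_ne_coe _)⟩

end Minimizers

/-! ### Exponential bounds for independent degrees -/

section Chernoff

open Finset

lemma exp_le_one_add_add_sq_mul (x : ℝ) : Real.exp x ≤ 1 + x + x ^ 2 * Real.exp |x| := by
  have h1 : 1 ≤ Real.exp |x| := Real.one_le_exp (abs_nonneg x)
  rcases le_or_gt |x| 1 with h | h
  · have := (abs_le.1 (Real.abs_exp_sub_one_sub_id_le h)).2
    nlinarith [sq_nonneg x]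
  · rcases le_or_gt 0 x with hx | hx
    · rw [abs_of_nonneg hx] at h h1 ⊢
      nlinarith [mul_nonneg (show 0 ≤ x ^ 2 - 1 by nlinarith) (Real.exp_pos x).le]
    · have h2 : Real.exp x ≤ 1 := Real.exp_le_one_iff.2 hx.le
      rw [abs_of_neg hx] at h h1 ⊢
      nlinarith [sq_nonneg x]

open Classical in
/-- The probability of `B` under the product of `n` copies of `μ`, restricted to the values in the
finite set `S`. -/
def prodMass (μ : FinMean) {n : ℕ} (S : Finset ℕ) (B : Set (Fin n → ℕ)) : ℝ :=
  ∑ d ∈ Fintype.piFinset (fun _ : Fin n => S) with d ∈ B, ∏ v, μ.mass (d v)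

lemma prod_mass_nonneg (μ : FinMean) {n : ℕ} (d : Fin n → ℕ) : 0 ≤ ∏ v, μ.mass (d v) :=
  prod_nonneg fun _ _ => μ.mass_nonneg _

lemma prodMass_mono (μ : FinMean) {n : ℕ} (S : Finset ℕ) {A B : Set (Fin n → ℕ)} (h : A ⊆ B) :
    prodMass μ S A ≤ prodMass μ S B := by
  classical
  exact sum_le_sum_of_subset_of_nonneg (monotone_filter_right _ fun _ _ hd => h hd)
    fun d _ _ => prod_mass_nonneg μ d

lemma prodMass_union_le (μ : FinMean) {n : ℕ} (S : Finset ℕ) (A B : Set (Fin n → ℕ)) :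
    prodMass μ S (A ∪ B) ≤ prodMass μ S A + prodMass μ S B := by
  classical
  unfold prodMass
  rw [sum_filter, sum_filter, sum_filter, ← sum_add_distrib]
  refine sum_le_sum fun d _ => ?_
  have := prod_mass_nonneg μ d
  by_cases hA : d ∈ A <;> by_cases hB : d ∈ B <;> simp [hA, hB, this]

lemma prodMass_univ (μ : FinMean) {n : ℕ} (S : Finset ℕ) :
    prodMass μ S (Set.univ : Set (Fin n → ℕ)) = (∑ i ∈ S, μ.mass i) ^ n := by
  classical
  unfold prodMass
  simp only [Set.mem_univ, filter_true]
  rw [← prod_univ_sum]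
  simp

/-- The events `B n` have exponentially small probability for independent `μ`-distributed
degrees. -/
def ExpSmall (μ : FinMean) (B : ∀ n : ℕ, Set (Fin n → ℕ)) : Prop :=
  ∃ c > 0, ∃ C, ∀ n : ℕ, 0 < n → ∀ S, prodMass μ S (B n) ≤ C * Real.exp (-c * n)

lemma ExpSmall.mono {μ : FinMean} {A B : ∀ n : ℕ, Set (Fin n → ℕ)} (hB : ExpSmall μ B)
    (h : ∀ n, 0 < n → A n ⊆ B n) : ExpSmall μ A := by
  obtain ⟨c, hc, C, hb⟩ := hB
  exact ⟨c, hc, C, fun n hn S => (prodMass_mono μ S (h n hn)).trans (hb n hn S)⟩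

lemma ExpSmall.union {μ : FinMean} {A B : ∀ n : ℕ, Set (Fin n → ℕ)} (hA : ExpSmall μ A)
    (hB : ExpSmall μ B) : ExpSmall μ fun n => A n ∪ B n := by
  obtain ⟨a, ha, C, hb⟩ := hA
  obtain ⟨b, hb0, D, hd⟩ := hB
  refine ⟨min a b, lt_min ha hb0, |C| + |D|, fun n hn S => (prodMass_union_le μ S _ _).trans ?_⟩
  rw [add_mul]
  refine add_le_add ((hb n hn S).trans ?_) ((hd n hn S).trans ?_)
  · exact mul_le_mul (le_abs_self _) (Real.exp_le_exp.2 (by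
      have := min_le_left a b; gcongr)) (Real.exp_pos _).le (abs_nonneg _)
  · exact mul_le_mul (le_abs_self _) (Real.exp_le_exp.2 (by
      have := min_le_right a b; gcongr)) (Real.exp_pos _).le (abs_nonneg _)

lemma expSmall_empty (μ : FinMean) : ExpSmall μ fun _ => ∅ :=
  ⟨1, one_pos, 0, fun n _ S => by simp [prodMass]⟩

lemma expSmall_biUnion {μ : FinMean} {ι : Type*} (T : Finset ι)
    {B : ι → ∀ n : ℕ, Set (Fin n → ℕ)} (h : ∀ i ∈ T, ExpSmall μ (B i)) :
    ExpSmall μ fun n => ⋃ i ∈ T, B i n := by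
  classical
  induction T using Finset.induction_on with
  | empty => simpa using expSmall_empty μ
  | insert a T ha ih =>
    simp only [Finset.set_biUnion_insert]
    exact (h a (mem_insert_self _ _)).union (ih fun i hi => h i (mem_insert_of_mem hi))

lemma expSmall_of_neg_mean {μ : FinMean} {X : ℕ → ℝ} {s : ℝ} (hs : s < 0)
    (hX : HasSum (fun i => μ.mass i * X i) s)
    (hV : Summable fun i => μ.mass i * (X i ^ 2 * Real.exp |X i|)) :
    ExpSmall μ fun _ => {d | 0 ≤ ∑ v, X (d v)} := by
  classical
  set V := ∑' i, μ.mass i * (X i ^ 2 * Real.exp |X i|) with hVdef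
  have hV0 : 0 ≤ V := tsum_nonneg fun i => mul_nonneg (μ.mass_nonneg i) (by positivity)
  set t := min 1 (-s / (2 * (V + 1))) with ht
  have ht0 : 0 < t := lt_min one_pos (div_pos (by linarith) (by positivity))
  have ht1 : t ≤ 1 := min_le_left _ _
  have htV : t * V ≤ -s / 2 := by
    have h1 : t * (2 * (V + 1)) ≤ -s := by
      rw [← le_div_iff₀ (by positivity)]
      exact min_le_right _ _
    nlinarith
  have hmgf : ∀ S : Finset ℕ, ∑ i ∈ S, μ.mass i * Real.exp (t * X i) ≤ Real.exp (t * s / 2) := by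
    intro S
    have hsum := (μ.hasSum_mass.add (hX.mul_left t)).add (hV.hasSum.mul_left (t ^ 2))
    have hle : ∀ i, μ.mass i * Real.exp (t * X i) ≤ μ.mass i + t * (μ.mass i * X i)
        + t ^ 2 * (μ.mass i * (X i ^ 2 * Real.exp |X i|)) := by
      intro i
      have h1 := exp_le_one_add_add_sq_mul (t * X i)
      have h2 : Real.exp |t * X i| ≤ Real.exp |X i| := by
        rw [abs_mul, abs_of_pos ht0]
        exact Real.exp_le_exp.2 (mul_le_of_le_one_left (abs_nonneg _) ht1)
      have h3 : Real.exp (t * X i) ≤ 1 + t * X i + (t * X i) ^ 2 * Real.exp |X i| :=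
        h1.trans (by gcongr)
      calc μ.mass i * Real.exp (t * X i)
          ≤ μ.mass i * (1 + t * X i + (t * X i) ^ 2 * Real.exp |X i|) :=
            mul_le_mul_of_nonneg_left h3 (μ.mass_nonneg i)
        _ = _ := by ring
    have hnn : ∀ i, 0 ≤ μ.mass i + t * (μ.mass i * X i)
        + t ^ 2 * (μ.mass i * (X i ^ 2 * Real.exp |X i|)) := fun i =>
      (mul_nonneg (μ.mass_nonneg i) (Real.exp_pos _).le).trans (hle i)
    calc ∑ i ∈ S, μ.mass i * Real.exp (t * X i) ≤ _ := sum_le_sum fun i _ => hle i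
      _ ≤ 1 + t * s + t ^ 2 * V := sum_le_hasSum S (fun i _ => hnn i) hsum
      _ ≤ t * s / 2 + 1 := by nlinarith
      _ ≤ _ := Real.add_one_le_exp _
  refine ⟨-(t * s / 2), by nlinarith, 1, fun n _ S => ?_⟩
  have hnn : ∀ S : Finset ℕ, 0 ≤ ∑ i ∈ S, μ.mass i * Real.exp (t * X i) := fun S =>
    sum_nonneg fun i _ => mul_nonneg (μ.mass_nonneg i) (Real.exp_pos _).le
  calc prodMass μ S {d : Fin n → ℕ | 0 ≤ ∑ v, X (d v)}
      ≤ ∑ d ∈ Fintype.piFinset (fun _ : Fin n => S),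
          ∏ v, (μ.mass (d v) * Real.exp (t * X (d v))) := by
        unfold prodMass
        rw [sum_filter]
        refine sum_le_sum fun d _ => ?_
        rw [prod_mul_distrib, ← Real.exp_sum, ← mul_sum]
        have h0 := prod_mass_nonneg μ d
        split_ifs with hd
        · exact le_mul_of_one_le_right h0 (Real.one_le_exp (mul_nonneg ht0.le hd))
        · positivity
    _ = (∑ i ∈ S, μ.mass i * Real.exp (t * X i)) ^ n := by
        rw [← prod_univ_sum (fun _ : Fin n => S) fun _ i => μ.mass i * Real.exp (t * X i)]
        simp
    _ ≤ Real.exp (t * s / 2) ^ n := pow_le_pow_left₀ (hnn S) (hmgf S) n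
    _ = _ := by rw [← Real.exp_nat_mul]; ring_nf

lemma expSmall_of_le_add {μ : FinMean} (hμ : Summable fun i : ℕ => μ.mass i * Real.exp (2 * i))
    {g : ℕ → ℝ} (hg : ∀ i : ℕ, |g i| ≤ i + 1) {δ : ℝ} (hδ : 0 < δ) :
    ExpSmall μ fun n => {d | n * (μ.expect g + δ) ≤ ∑ v, g (d v)} := by
  have hgs : Summable fun i => μ.mass i * g i := by
    refine summable_mass_mul ((linearGrowth_iff g).2 ⟨1, zero_le_one, fun i => ?_⟩) μ
    rw [one_mul]; exact hg i
  set a := μ.expect g + δ with ha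
  have hX : HasSum (fun i => μ.mass i * (g i - a)) (μ.expect g - 1 * a) := by
    simp only [mul_sub]
    exact hgs.hasSum.sub (μ.hasSum_mass.mul_right a)
  refine (expSmall_of_neg_mean (by linarith) hX ?_).mono fun n _ d hd => ?_
  · refine Summable.of_nonneg_of_le (fun i => mul_nonneg (μ.mass_nonneg i) (by positivity))
      (fun i => ?_) (hμ.mul_left (2 * Real.exp (2 * (1 + |a|))))
    have h1 : |g i - a| ≤ i + (1 + |a|) := (abs_sub _ _).trans (by linarith [hg i])
    have h2 : (g i - a) ^ 2 ≤ 2 * Real.exp |g i - a| := by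
      have := Real.quadratic_le_exp_of_nonneg (abs_nonneg (g i - a))
      rw [sq_abs] at this
      linarith [abs_nonneg (g i - a)]
    have h3 : (g i - a) ^ 2 * Real.exp |g i - a|
        ≤ 2 * Real.exp (2 * (1 + |a|)) * Real.exp (2 * i) := by
      calc (g i - a) ^ 2 * Real.exp |g i - a| ≤ 2 * Real.exp |g i - a| * Real.exp |g i - a| := by
            gcongr
        _ = 2 * Real.exp (2 * |g i - a|) := by rw [mul_assoc, ← Real.exp_add]; ring_nf
        _ ≤ 2 * Real.exp (2 * (i + (1 + |a|))) := by gcongr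
        _ = _ := by rw [mul_assoc, ← Real.exp_add]; ring_nf
    nlinarith [mul_le_mul_of_nonneg_left h3 (μ.mass_nonneg i)]
  · simp only [Set.mem_ofPred_eq, sum_sub_distrib, sum_const, card_univ, Fintype.card_fin,
      nsmul_eq_mul, sub_nonneg] at hd ⊢
    exact hd

lemma summable_mass_sigma_mul_exp {F : ℕ → ℝ} (hF : LinearGrowth F) (θ : ℝ≥0) :
    Summable fun i : ℕ => (sigma F hF θ).mass i * Real.exp (2 * i) := by
  refine ((summable_sigmaWeight hF (θ * (Real.exp 2).toNNReal)).mul_left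
    (Real.exp (-logPartition F θ))).congr fun i => ?_
  rw [mass_sigma, sigmaWeight, sigmaWeight, mul_comm (2 : ℝ), Real.exp_nat_mul, NNReal.coe_mul,
    mul_pow, Real.coe_toNNReal _ (Real.exp_pos _).le]
  ring

/-- The distance of the empirical distribution of `d` to `μ`. -/
def empDist {n : ℕ} (d : Fin n → ℕ) (μ : FinMean) : ℝ :=
  ∑' i : ℕ, (i : ℝ) * |((univ.filter fun v => d v = i).card : ℝ) / n - μ.mass i|

lemma card_filter_eq_sum {n : ℕ} (d : Fin n → ℕ) (i : ℕ) :
    ((univ.filter fun v => d v = i).card : ℝ) = ∑ v, if d v = i then (1 : ℝ) else 0 := by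
  rw [← sum_filter]; simp

lemma empDist_le {n : ℕ} (d : Fin n → ℕ) (μ : FinMean) (K : ℕ) :
    empDist d μ ≤ (∑ i ∈ range K,
        (i : ℝ) * |((univ.filter fun v => d v = i).card : ℝ) / n - μ.mass i|)
      + (∑ v, if K ≤ d v then (d v : ℝ) else 0) / n
      + ∑' i : ℕ, μ.mass i * (if K ≤ i then (i : ℝ) else 0) := by
  set e : ℕ → ℝ := fun i => ((univ.filter fun v => d v = i).card : ℝ) / n with he
  have he0 : ∀ i, 0 ≤ e i := fun i => by rw [he]; positivity
  have hse : HasSum (fun i : ℕ => e i * (if K ≤ i then (i : ℝ) else 0))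
      ((∑ v, if K ≤ d v then (d v : ℝ) else 0) / n) := by
    have h : ∀ v : Fin n, HasSum (fun i : ℕ => (if d v = i then (1 : ℝ) else 0) *
        (if K ≤ i then (i : ℝ) else 0)) (if K ≤ d v then (d v : ℝ) else 0) := fun v => by
      convert hasSum_single (f := fun i : ℕ => (if d v = i then (1 : ℝ) else 0) *
        (if K ≤ i then (i : ℝ) else 0)) (d v) (fun i hi => by simp [hi.symm]) using 1
      simp
    have h2 := (hasSum_sum fun v (_ : v ∈ univ) => h v).div_const (n : ℝ)
    refine h2.congr_fun fun i => ?_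
    rw [he, ← sum_mul, ← card_filter_eq_sum]
    ring
  have hsμ : Summable fun i : ℕ => μ.mass i * (if K ≤ i then (i : ℝ) else 0) :=
    Summable.of_nonneg_of_le (fun i => mul_nonneg (μ.mass_nonneg i) (by split_ifs <;> positivity))
      (fun i => by
        rw [mul_comm]
        refine mul_le_mul_of_nonneg_right ?_ (μ.mass_nonneg i)
        split_ifs <;> simp) μ.summable_mean
  have hfin : HasSum (fun i : ℕ => if i ∈ range K then (i : ℝ) * |e i - μ.mass i| else 0)
      (∑ i ∈ range K, (i : ℝ) * |e i - μ.mass i|) := by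
    have : HasSum (fun i : ℕ => if i ∈ range K then (i : ℝ) * |e i - μ.mass i| else 0)
        (∑ i ∈ range K, if i ∈ range K then (i : ℝ) * |e i - μ.mass i| else 0) :=
      hasSum_sum_of_ne_finset_zero fun i hi => if_neg hi
    rwa [sum_congr rfl fun i hi => if_pos hi] at this
  have htot := (hfin.add hse).add hsμ.hasSum
  have hle : ∀ i : ℕ, (i : ℝ) * |e i - μ.mass i| ≤
      (if i ∈ range K then (i : ℝ) * |e i - μ.mass i| else 0)
      + e i * (if K ≤ i then (i : ℝ) else 0) + μ.mass i * (if K ≤ i then (i : ℝ) else 0) := by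
    intro i
    by_cases hi : i < K
    · simp [hi, not_le.2 hi]
    · have hi' := not_lt.1 hi
      have : |e i - μ.mass i| ≤ e i + μ.mass i :=
        (abs_sub _ _).trans (by rw [abs_of_nonneg (he0 i), abs_of_nonneg (μ.mass_nonneg i)])
      simp only [mem_range, hi, if_false, hi', if_true]
      nlinarith [mul_le_mul_of_nonneg_left this (Nat.cast_nonneg (α := ℝ) i)]
  have hs : Summable fun i : ℕ => (i : ℝ) * |e i - μ.mass i| :=
    Summable.of_nonneg_of_le (fun i => by positivity) hle htot.summable
  exact (hs.tsum_le_tsum hle htot.summable).trans_eq htot.tsum_eq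

lemma exists_tail_lt (μ : FinMean) {ε : ℝ} (hε : 0 < ε) :
    ∃ K : ℕ, ∑' i : ℕ, μ.mass i * (if K ≤ i then (i : ℝ) else 0) < ε := by
  have h := tendsto_sum_nat_add fun i : ℕ => (i : ℝ) * μ.mass i
  obtain ⟨K, hK⟩ := (h.eventually (gt_mem_nhds hε)).exists
  refine ⟨K, lt_of_eq_of_lt ?_ hK⟩
  have hinj : Function.Injective fun i : ℕ => i + K := add_left_injective K
  rw [← hinj.tsum_eq (f := fun i : ℕ => μ.mass i * (if K ≤ i then (i : ℝ) else 0))]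
  · simp [mul_comm]
  · intro i hi
    have : K ≤ i := by
      by_contra hlt
      simp [hlt] at hi
    exact ⟨i - K, Nat.sub_add_cancel this⟩

/-- The empirical distribution of independent degrees is exponentially close to `μ`. -/
lemma expSmall_empDist {μ : FinMean} (hμ : Summable fun i : ℕ => μ.mass i * Real.exp (2 * i))
    {ε : ℝ} (hε : 0 < ε) : ExpSmall μ fun _ => {d | ε ≤ empDist d μ} := by
  obtain ⟨K, hK⟩ := exists_tail_lt μ (show 0 < ε / 4 by positivity)
  set δ := ε / (4 * (K + 1) ^ 2) with hδ
  have hδ0 : 0 < δ := by positivity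
  set tail : ℕ → ℝ := fun i => if K ≤ i then (i : ℝ) else 0 with htail
  set ind : ℕ → ℕ → ℝ := fun k i => if i = k then 1 else 0 with hind
  have h1 : ExpSmall μ fun n => {d | n * (μ.expect tail + ε / 4) ≤ ∑ v, tail (d v)} :=
    expSmall_of_le_add hμ (fun i => by
      rw [htail]
      dsimp only
      split_ifs
      · simp
      · rw [abs_zero]; positivity) (by positivity)
  have h2 : ∀ k ∈ range K,
      ExpSmall μ fun n => {d | n * (μ.expect (ind k) + δ) ≤ ∑ v, ind k (d v)} :=
    fun k _ => expSmall_of_le_add hμ (fun i => by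
      rw [hind]
      dsimp only
      split_ifs
      · simp
      · rw [abs_zero]; positivity) hδ0
  have h3 : ∀ k ∈ range K,
      ExpSmall μ fun n => {d | n * (μ.expect (fun i => -ind k i) + δ) ≤ ∑ v, -ind k (d v)} :=
    fun k _ => expSmall_of_le_add hμ (fun i => by
      rw [hind, abs_neg]
      dsimp only
      split_ifs
      · simp
      · rw [abs_zero]; positivity) hδ0
  have hexp : ∀ k, μ.expect (ind k) = μ.mass k := fun k => by
    rw [FinMean.expect, tsum_eq_single k (fun i hi => by simp [hind, hi])]
    simp [hind]
  have hexp' : ∀ k, μ.expect (fun i => -ind k i) = -μ.mass k := fun k => by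
    rw [← hexp k, FinMean.expect, FinMean.expect, ← tsum_neg]
    simp
  refine (h1.union ((expSmall_biUnion _ h2).union (expSmall_biUnion _ h3))).mono ?_
  intro n hn d hd
  have hn' : (0 : ℝ) < n := by exact_mod_cast hn
  by_contra hc
  simp only [Set.mem_union, Set.mem_iUnion, Set.mem_ofPred_eq, not_or, not_exists, not_le,
    exists_prop, not_and, hexp, hexp'] at hc
  obtain ⟨c1, c2, c3⟩ := hc
  have hcard : ∀ k, ∑ v, ind k (d v) = ((univ.filter fun v => d v = k).card : ℝ) := fun k =>
    (card_filter_eq_sum d k).symm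
  have hb : ∀ k ∈ range K,
      (k : ℝ) * |((univ.filter fun v => d v = k).card : ℝ) / n - μ.mass k| ≤ K * δ := by
    intro k hk
    have d2 := c2 k hk
    have d3 := c3 k hk
    rw [sum_neg_distrib] at d3
    rw [hcard] at d2 d3
    have hkK : (k : ℝ) ≤ K := by exact_mod_cast (mem_range.1 hk).le
    refine mul_le_mul hkK ?_ (abs_nonneg _) (by positivity)
    rw [abs_le, div_sub' hn'.ne']
    constructor
    · rw [le_div_iff₀ hn']; nlinarith
    · rw [div_le_iff₀ hn']; nlinarith
  have hsum : ∑ k ∈ range K,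
      (k : ℝ) * |((univ.filter fun v => d v = k).card : ℝ) / n - μ.mass k| ≤ ε / 4 := by
    refine (sum_le_sum hb).trans ?_
    rw [sum_const, card_range, nsmul_eq_mul, hδ, ← mul_assoc, mul_div_assoc',
      div_le_iff₀ (by positivity)]
    have : (0 : ℝ) ≤ K := by positivity
    nlinarith
  have htl : (∑ v, if K ≤ d v then (d v : ℝ) else 0) / n < μ.expect tail + ε / 4 := by
    rw [div_lt_iff₀ hn', mul_comm]
    exact c1
  have hK' : μ.expect tail < ε / 4 := hK
  have := empDist_le d μ K
  have hd : ε ≤ empDist d μ := hd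
  change _ ≤ _ + _ + μ.expect tail at this
  linarith

end Chernoff

/-! ### Upper bounds for the graphs with a given number of edges -/

section UpperBound

open Finset

variable {F : ℕ → ℝ}

/-- The exponent of the graphs with `nx/2` edges, for the tilt `θ`; it equals `H` at the mean of
`σ_θ`. -/
def levelRate (β : ℝ) (F : ℕ → ℝ) (θ : ℝ≥0) (x : ℝ) : ℝ :=
  x * Real.log θ - logPartition F θ - x / 2 * Real.log (x * β) + (x + β) / 2

lemma levelRate_mean (β : ℝ) (hF : LinearGrowth F) (θ : ℝ≥0) :
    levelRate β F θ (sigma F hF θ).mean = H β F hF θ := rfl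

lemma continuous_levelRate {β : ℝ} (hβ : 0 < β) (F : ℕ → ℝ) (θ : ℝ≥0) :
    Continuous (levelRate β F θ) := by
  have h := continuous_half_mul_log hβ
  unfold levelRate
  fun_prop

lemma log_factorial_two_mul_div_le (E : ℕ) :
    Real.log ((2 * E).factorial / (2 ^ E * E.factorial))
      ≤ Real.log (E + 1) + E * Real.log (2 * E) - E := by
  rcases Nat.eq_zero_or_pos E with rfl | hE
  · simp
  induction E, hE using Nat.le_induction with
  | base =>
    have h2 := Real.log_two_gt_d9
    norm_num [Nat.factorial]
    linarith
  | succ E hE ih =>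
    have hE' : (1 : ℝ) ≤ E := by exact_mod_cast hE
    have hE0 : (0 : ℝ) < E := by linarith
    have hrec : ((2 * (E + 1)).factorial : ℝ) / (2 ^ (E + 1) * (E + 1).factorial)
        = (2 * E + 1) * ((2 * E).factorial / (2 ^ E * E.factorial)) := by
      rw [show 2 * (E + 1) = 2 * E + 1 + 1 by ring, Nat.factorial_succ, Nat.factorial_succ,
        Nat.factorial_succ E, pow_succ]
      push_cast
      field_simp
      ring
    rw [hrec, Real.log_mul (by positivity) (by positivity)]
    push_cast
    have h1 : 1 / ((E : ℝ) + 1) ≤ Real.log (E + 1) - Real.log E := by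
      have := Real.log_le_sub_one_of_pos (show 0 < (E : ℝ) / (E + 1) by positivity)
      rw [Real.log_div hE0.ne' (by positivity)] at this
      have h : (E : ℝ) / (E + 1) - 1 = -(1 / (E + 1)) := by field_simp; ring
      linarith
    have h2 : Real.log (2 * E + 1) + Real.log (E + 1)
        ≤ Real.log E + Real.log 2 + Real.log (E + 2) := by
      rw [← Real.log_mul (by positivity) (by positivity), ← Real.log_mul (by positivity)
        (by positivity), ← Real.log_mul (by positivity) (by positivity)]
      apply Real.log_le_log (by positivity)
      nlinarith
    have h3 : ((E : ℝ) + 1) * (1 / (E + 1)) = 1 := by field_simp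
    have h4 := mul_le_mul_of_nonneg_left h1 (show (0 : ℝ) ≤ E + 1 by positivity)
    rw [Real.log_mul two_ne_zero hE0.ne'] at ih
    rw [Real.log_mul two_ne_zero (by positivity), show (E : ℝ) + 1 + 1 = E + 2 by ring]
    nlinarith

lemma prod_sigmaWeight_eq_sigma {n : ℕ} (hF : LinearGrowth F) (θ : ℝ≥0) (d : Fin n → ℕ) :
    ∏ v, sigmaWeight F θ (d v)
      = Real.exp (n * logPartition F θ) * ∏ v, (sigma F hF θ).mass (d v) := by
  simp only [mass_sigma, prod_mul_distrib, prod_const, card_univ, Fintype.card_fin]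
  rw [← mul_assoc, ← Real.exp_nat_mul, ← Real.exp_add]
  simp

lemma prodMass_le_one (μ : FinMean) {n : ℕ} (S : Finset ℕ) (B : Set (Fin n → ℕ)) :
    prodMass μ S B ≤ 1 := by
  refine (prodMass_mono μ S (Set.subset_univ B)).trans ?_
  rw [prodMass_univ]
  exact pow_le_one₀ (sum_nonneg fun i _ => μ.mass_nonneg i)
    (sum_le_hasSum S (fun i _ => μ.mass_nonneg i) μ.hasSum_mass)

lemma prodMass_nonneg (μ : FinMean) {n : ℕ} (S : Finset ℕ) (B : Set (Fin n → ℕ)) :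
    0 ≤ prodMass μ S B := sum_nonneg fun d _ => prod_mass_nonneg μ d

lemma levelWeight_le {β : ℝ} (hβ : 0 < β) {n : ℕ} (hn : β < n) (hF : LinearGrowth F)
    (B : Set (Fin n → ℕ)) {E : ℕ} (hE : E ≤ n.choose 2) {θ : ℝ≥0} (hθ : θ ≠ 0 ∨ E = 0) :
    levelWeight β F B E ≤ (E + 1) * Real.exp (β / 2 + β * (2 * E / n) / 2)
      * Real.exp (-(n * levelRate β F θ (2 * E / n))) * prodMass (sigma F hF θ) (range n) B := by
  classical
  have hn0 : (0 : ℝ) < n := hβ.trans hn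
  have h := pow_mul_levelWeight_le hβ.le hn.le F B E θ
  have hsum : ∑ d ∈ Fintype.piFinset (fun _ : Fin n => range n) with d ∈ B,
      ∏ v, sigmaWeight F θ (d v)
      = Real.exp (n * logPartition F θ) * prodMass (sigma F hF θ) (range n) B := by
    rw [prodMass, mul_sum]
    exact sum_congr rfl fun d _ => prod_sigmaWeight_eq_sigma hF θ d
  rw [hsum, ← mul_assoc] at h
  have hθE : (θ : ℝ) ^ (2 * E) = Real.exp (2 * E * Real.log θ) := by
    rcases hθ with hθ | hθ
    · have : (0 : ℝ) < θ := by exact_mod_cast pos_iff_ne_zero.2 hθ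
      rw [show 2 * (E : ℝ) * Real.log θ = ((2 * E : ℕ) : ℝ) * Real.log θ by push_cast; ring,
        Real.exp_nat_mul, Real.exp_log this]
    · simp [hθ]
  have hβE : (β / n) ^ E = Real.exp (E * Real.log (β / n)) := by
    rw [Real.exp_nat_mul, Real.exp_log (by positivity)]
  have hchoose : ((n.choose 2 - E : ℕ) : ℝ) = n * (n - 1) / 2 - E := by
    rw [Nat.cast_sub hE, Nat.cast_choose_two]
  have h1E : (1 - β / n) ^ (n.choose 2 - E) ≤ Real.exp (-(β / n) * (n * (n - 1) / 2 - E)) := by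
    rw [← hchoose, mul_comm, Real.exp_nat_mul]
    refine pow_le_pow_left₀ ?_ (Real.one_sub_le_exp_neg _) _
    rw [sub_nonneg, div_le_one hn0]
    exact hn.le
  have hdf : ((2 * E).factorial : ℝ) / (2 ^ E * E.factorial)
      ≤ (E + 1) * Real.exp (E * Real.log (2 * E) - E) := by
    have h1 := log_factorial_two_mul_div_le E
    rw [Real.log_le_iff_le_exp (by positivity), add_sub_assoc, Real.exp_add,
      Real.exp_log (by positivity)] at h1
    exact h1
  have hlog : (E : ℝ) * Real.log (2 * E / n * β)
      = E * Real.log (2 * E) + E * Real.log (β / n) := by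
    rcases Nat.eq_zero_or_pos E with h0 | h0
    · simp [h0]
    · have : (0 : ℝ) < E := by exact_mod_cast h0
      rw [show 2 * (E : ℝ) / n * β = 2 * E * (β / n) by ring,
        Real.log_mul (by positivity) (by positivity), mul_add]
  set p := prodMass (sigma F hF θ) (range n) B with hp
  have hp0 : 0 ≤ p := prodMass_nonneg _ _ _
  rw [hθE] at h
  have h2 : Real.exp (2 * E * Real.log θ) * levelWeight β F B E ≤
      Real.exp (E * Real.log (β / n)) * Real.exp (-(β / n) * (n * (n - 1) / 2 - E))
        * ((E + 1) * Real.exp (E * Real.log (2 * E) - E))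
        * Real.exp (n * logPartition F θ) * p := by
    refine h.trans ?_
    rw [hβE]
    gcongr
  have h3 : levelWeight β F B E = Real.exp (-(2 * E * Real.log θ))
      * (Real.exp (2 * E * Real.log θ) * levelWeight β F B E) := by
    rw [← mul_assoc, ← Real.exp_add]
    simp
  rw [h3]
  refine (mul_le_mul_of_nonneg_left h2 (Real.exp_pos _).le).trans_eq ?_
  have hrate : (n : ℝ) * levelRate β F θ (2 * E / n) = 2 * E * Real.log θ - n * logPartition F θ
      - (E * Real.log (2 * E) + E * Real.log (β / n)) + E + n * β / 2 := by
    rw [← hlog, levelRate]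
    field_simp
    ring
  have hb : -(β / n) * (n * (n - 1) / 2 - E) = -(n * β / 2) + β / 2 + β * (2 * E / n) / 2 := by
    field_simp
    ring
  rw [hrate, hb]
  have : ∀ a b c d e : ℝ, Real.exp a * (Real.exp b * Real.exp c * ((E + 1) * Real.exp d)
      * Real.exp e * p) = (E + 1) * Real.exp (a + b + c + d + e) * p := fun a b c d e => by
    simp only [Real.exp_add]; ring
  rw [this, mul_assoc ((E : ℝ) + 1) (Real.exp _) (Real.exp _), ← Real.exp_add]
  ring_nf

lemma eventually_add_mul_log_le (a b : ℝ) {ε : ℝ} (hε : 0 < ε) :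
    ∀ᶠ n : ℕ in atTop, a + b * Real.log n ≤ n * ε := by
  have h1 : (fun x : ℝ => a + b * Real.log x) =o[atTop] fun x : ℝ => x :=
    (Asymptotics.isLittleO_const_id_atTop a).add
      (Real.isLittleO_log_id_atTop.const_mul_left b)
  have h2 := (h1.comp_tendsto tendsto_natCast_atTop_atTop).bound hε
  filter_upwards [h2] with n hn
  simp only [Function.comp, Real.norm_eq_abs, Nat.abs_cast] at hn
  linarith [le_abs_self (a + b * Real.log n)]

lemma choose_two_add_one_le {n : ℕ} (hn : 0 < n) :
    (n.choose 2 : ℝ) + 1 ≤ Real.exp (2 * Real.log n) := by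
  have hn' : (1 : ℝ) ≤ n := by exact_mod_cast hn
  rw [Nat.cast_choose_two, show 2 * Real.log n = ((2 : ℕ) : ℝ) * Real.log n by norm_num,
    Real.exp_nat_mul, Real.exp_log (by linarith)]
  nlinarith

/-- Graphs whose edge density has free energy at least `b`. -/
lemma eventually_levelWeight_le {β : ℝ} (hβ : 0 < β) (hF : LinearGrowth F) {D : Set ℝ≥0} {b : ℝ}
    (hb : ∀ θ ∈ D, b ≤ H β F hF θ) {η : ℝ} (hη : 0 < η) :
    ∀ᶠ n : ℕ in atTop, ∀ (B : Set (Fin n → ℕ)), ∀ E ≤ n.choose 2, ∀ θ ∈ D,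
      (sigma F hF θ).mean = 2 * E / n → levelWeight β F B E ≤ Real.exp (-(n * (b - η))) := by
  obtain ⟨A, hA⟩ := exists_mean_sub_le_H hβ hF 1
  filter_upwards [eventually_add_mul_log_le (β / 2 + β / 2 * (b + A)) 2 hη,
    tendsto_natCast_atTop_atTop.eventually_gt_atTop β, eventually_gt_atTop 0]
    with n hlog hn hn0 B E hE θ hθ hm
  have hn0' : (0 : ℝ) < n := by exact_mod_cast hn0
  have hθE : θ ≠ 0 ∨ E = 0 := by
    by_cases h : θ = 0
    · right
      rw [h, mean_sigma_zero] at hm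
      have : (E : ℝ) = 0 := by
        field_simp at hm
        linarith
      exact_mod_cast this
    · exact Or.inl h
  refine (levelWeight_le hβ hn hF B hE hθE).trans ?_
  rw [← hm, levelRate_mean]
  set x := (sigma F hF θ).mean
  have h1 : (E : ℝ) + 1 ≤ Real.exp (2 * Real.log n) := by
    refine le_trans ?_ (choose_two_add_one_le hn0)
    gcongr
  have h2 := prodMass_le_one (sigma F hF θ) (range n) B
  have h3 := prodMass_nonneg (sigma F hF θ) (range n) B
  calc _ ≤ Real.exp (2 * Real.log n) * Real.exp (β / 2 + β * x / 2)
        * Real.exp (-(n * H β F hF θ)) * 1 := by gcongr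
    _ = Real.exp (2 * Real.log n + (β / 2 + β * x / 2) + -(n * H β F hF θ)) := by
        simp only [Real.exp_add, mul_one]
    _ ≤ _ := by
        apply Real.exp_le_exp.2
        have h4 := mul_le_mul_of_nonneg_left (hb θ hθ) (show 0 ≤ (n : ℝ) - β / 2 by linarith)
        have h5 := mul_le_mul_of_nonneg_left (hA θ) (show 0 ≤ β / 2 by linarith)
        nlinarith

/-- Graphs with edge density close to the mean of `σ_θ` whose degree distribution is far from
`σ_θ`. -/
lemma exists_levelWeight_empDist_le {β : ℝ} (hβ : 0 < β) (hF : LinearGrowth F) {θ : ℝ≥0}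
    (hθ : θ ≠ 0) {ε : ℝ} (hε : 0 < ε) :
    ∃ c > 0, ∃ δ > 0, ∀ᶠ n : ℕ in atTop, ∀ E ≤ n.choose 2,
      |2 * E / n - (sigma F hF θ).mean| < δ →
      levelWeight β F {d : Fin n → ℕ | ε ≤ empDist d (sigma F hF θ)} E
        ≤ Real.exp (-(n * (H β F hF θ + c))) := by
  obtain ⟨c, hc, C, hC⟩ := expSmall_empDist (summable_mass_sigma_mul_exp hF θ) hε
  set m := (sigma F hF θ).mean with hm
  have hev : ∀ᶠ x in 𝓝 m, H β F hF θ - c / 4 < levelRate β F θ x := by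
    refine (continuous_levelRate hβ F θ).continuousAt.eventually (lt_mem_nhds ?_)
    rw [hm, levelRate_mean]
    linarith
  obtain ⟨δ, hδ, hball⟩ := Metric.eventually_nhds_iff.1 hev
  refine ⟨c / 2, by positivity, min δ 1, by positivity, ?_⟩
  filter_upwards [eventually_add_mul_log_le (β / 2 + β * (m + 1) / 2 + Real.log (max C 1)) 2
    (show 0 < c / 4 by positivity), tendsto_natCast_atTop_atTop.eventually_gt_atTop β,
    eventually_gt_atTop 0] with n hlog hn hn0 E hE hx
  have hn0' : (0 : ℝ) < n := by exact_mod_cast hn0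
  refine (levelWeight_le hβ hn hF _ hE (Or.inl hθ)).trans ?_
  set x : ℝ := 2 * E / n
  have hx1 : x ≤ m + 1 := by
    have := (abs_lt.1 (hx.trans_le (min_le_right δ 1))).2
    linarith
  have hrate := hball (y := x) (by rw [Real.dist_eq]; exact hx.trans_le (min_le_left δ 1))
  have h1 : (E : ℝ) + 1 ≤ Real.exp (2 * Real.log n) := by
    refine le_trans ?_ (choose_two_add_one_le hn0)
    gcongr
  have h2 : prodMass (sigma F hF θ) (range n) {d : Fin n → ℕ | ε ≤ empDist d (sigma F hF θ)}
      ≤ Real.exp (Real.log (max C 1)) * Real.exp (-c * n) := by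
    rw [Real.exp_log (by positivity)]
    refine (hC n hn0 (range n)).trans ?_
    gcongr
    exact le_max_left _ _
  have h3 := prodMass_nonneg (sigma F hF θ) (range n)
    {d : Fin n → ℕ | ε ≤ empDist d (sigma F hF θ)}
  calc _ ≤ Real.exp (2 * Real.log n) * Real.exp (β / 2 + β * (m + 1) / 2)
        * Real.exp (-(n * (H β F hF θ - c / 4)))
        * (Real.exp (Real.log (max C 1)) * Real.exp (-c * n)) := by gcongr
    _ = Real.exp (2 * Real.log n + (β / 2 + β * (m + 1) / 2) + -(n * (H β F hF θ - c / 4))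
        + (Real.log (max C 1) + -c * n)) := by simp only [Real.exp_add]
    _ ≤ _ := by
        apply Real.exp_le_exp.2
        nlinarith

end UpperBound

/-! ### The lower bound for the partition function -/

section LowerBound

open Finset

variable {F : ℕ → ℝ}

/-- The truncated partition function `∑_{i ≤ K} θ^i e^{F(i)} / i!`. -/
def truncPartition (F : ℕ → ℝ) (θ : ℝ≥0) (K : ℕ) : ℝ := ∑ i ∈ range (K + 1), sigmaWeight F θ i

lemma truncPartition_pos (F : ℕ → ℝ) (θ : ℝ≥0) (K : ℕ) : 0 < truncPartition F θ K :=
  sum_pos' (fun i _ => sigmaWeight_nonneg F θ i)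
    ⟨0, by simp, sigmaWeight_pos F (Or.inr rfl)⟩

/-- The masses of `σ_θ` conditioned on `{0, …, K}`. -/
def truncMass (F : ℕ → ℝ) (θ : ℝ≥0) (K : ℕ) (i : ℕ) : ℝ :=
  if i ∈ range (K + 1) then sigmaWeight F θ i / truncPartition F θ K else 0

/-- `σ_θ` conditioned on `{0, …, K}`. -/
def truncSigma (F : ℕ → ℝ) (θ : ℝ≥0) (K : ℕ) : FinMean :=
  FinMean.ofMass (truncMass F θ K)
    (fun i => by
      unfold truncMass
      split_ifs
      · exact div_nonneg (sigmaWeight_nonneg _ _ _) (truncPartition_pos F θ K).le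
      · exact le_rfl)
    (by
      have h : HasSum (truncMass F θ K) (∑ i ∈ range (K + 1), truncMass F θ K i) :=
        hasSum_sum_of_ne_finset_zero fun i hi => if_neg hi
      have h1 : ∑ i ∈ range (K + 1), truncMass F θ K i = 1 := by
        unfold truncMass
        rw [sum_congr rfl fun i hi => if_pos hi, ← sum_div]
        exact div_self (truncPartition_pos F θ K).ne'
      rwa [h1] at h)
    (summable_of_ne_finset_zero (s := range (K + 1)) fun i hi => by
      rw [truncMass, if_neg hi, mul_zero])

lemma mass_truncSigma (F : ℕ → ℝ) (θ : ℝ≥0) (K i : ℕ) :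
    (truncSigma F θ K).mass i = truncMass F θ K i := FinMean.mass_ofMass _ _ _ _ _

lemma mean_truncSigma (F : ℕ → ℝ) (θ : ℝ≥0) (K : ℕ) :
    (truncSigma F θ K).mean
      = (∑ i ∈ range (K + 1), (i : ℝ) * sigmaWeight F θ i) / truncPartition F θ K := by
  rw [FinMean.mean, tsum_eq_sum (s := range (K + 1)) fun i hi => by
    rw [mass_truncSigma, truncMass, if_neg hi, mul_zero], sum_div]
  refine sum_congr rfl fun i hi => ?_
  rw [mass_truncSigma, truncMass, if_pos hi, mul_div_assoc]

lemma tendsto_truncPartition (hF : LinearGrowth F) (θ : ℝ≥0) :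
    Tendsto (truncPartition F θ) atTop (𝓝 (∑' i, sigmaWeight F θ i)) :=
  (summable_sigmaWeight hF θ).hasSum.tendsto_sum_nat.comp (tendsto_add_atTop_nat 1)

lemma tendsto_log_truncPartition (hF : LinearGrowth F) (θ : ℝ≥0) :
    Tendsto (fun K => Real.log (truncPartition F θ K)) atTop (𝓝 (logPartition F θ)) :=
  (tendsto_truncPartition hF θ).log (tsum_sigmaWeight_pos hF θ).ne'

lemma tendsto_mean_truncSigma (hF : LinearGrowth F) (θ : ℝ≥0) :
    Tendsto (fun K => (truncSigma F θ K).mean) atTop (𝓝 (sigma F hF θ).mean) := by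
  simp only [mean_truncSigma]
  have hs : HasSum (fun i : ℕ => (i : ℝ) * sigmaWeight F θ i)
      ((∑' i, sigmaWeight F θ i) * (sigma F hF θ).mean) := by
    have h := (sigma F hF θ).summable_mean.hasSum.mul_left (∑' i, sigmaWeight F θ i)
    refine h.congr_fun fun i => ?_
    rw [mass_sigma, logPartition, Real.exp_neg, Real.exp_log (tsum_sigmaWeight_pos hF θ)]
    have := (tsum_sigmaWeight_pos hF θ).ne'
    field_simp
  have h := (hs.tendsto_sum_nat.comp (tendsto_add_atTop_nat 1)).div
    (tendsto_truncPartition hF θ) (tsum_sigmaWeight_pos hF θ).ne'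
  rwa [mul_div_cancel_left₀ _ (tsum_sigmaWeight_pos hF θ).ne'] at h

lemma prod_sigmaWeight_eq_truncSigma {n : ℕ} (F : ℕ → ℝ) (θ : ℝ≥0) (K : ℕ)
    {d : Fin n → ℕ} (hd : ∀ v, d v ∈ range (K + 1)) :
    ∏ v, sigmaWeight F θ (d v)
      = truncPartition F θ K ^ n * ∏ v, (truncSigma F θ K).mass (d v) := by
  have h : ∀ v, (truncSigma F θ K).mass (d v) = sigmaWeight F θ (d v) / truncPartition F θ K :=
    fun v => by rw [mass_truncSigma, truncMass, if_pos (hd v)]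
  have := (truncPartition_pos F θ K).ne'
  simp only [h, prod_div_distrib, prod_const, card_univ, Fintype.card_fin]
  field_simp

lemma exists_exp_le_exp_mul (F : ℕ → ℝ) (K : ℕ) :
    ∃ M : ℝ, 1 ≤ M ∧ ∀ k d, k ≤ d → d ≤ K → Real.exp (F d) ≤ Real.exp (F k) * M := by
  set b := ∑ i ∈ range (K + 1), |F i| with hb
  have hle : ∀ i ≤ K, |F i| ≤ b := fun i hi =>
    single_le_sum (f := fun i => |F i|) (fun i _ => abs_nonneg _) (mem_range.2 (by omega))
  have hb0 : 0 ≤ b := sum_nonneg fun i _ => abs_nonneg _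
  refine ⟨Real.exp (2 * b), Real.one_le_exp (by positivity), fun k d hkd hd => ?_⟩
  rw [← Real.exp_add]
  apply Real.exp_le_exp.2
  linarith [le_abs_self (F d), neg_abs_le (F k), hle d hd, hle k (hkd.trans hd)]

/-- With probability at least `1 / (2 (nK + 1))` the degree sum is a suitable number. -/
lemma exists_degree_sum {μ : FinMean} {K : ℕ} (hμ : ∀ i, i ∉ range (K + 1) → μ.mass i = 0)
    {δ : ℝ} (hδ : 0 < δ) :
    ∀ᶠ n : ℕ in atTop, ∃ s : ℕ, s ≤ n * K ∧ |(s : ℝ) - n * μ.mean| < n * δ ∧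
      1 / (2 * (n * K + 1)) ≤ prodMass μ (range (K + 1)) {d : Fin n → ℕ | ∑ v, d v = s} := by
  classical
  have hexp : Summable fun i : ℕ => μ.mass i * Real.exp (2 * i) :=
    summable_of_ne_finset_zero (s := range (K + 1)) fun i hi => by rw [hμ i hi, zero_mul]
  have h1 := expSmall_of_le_add hexp (g := fun i => (i : ℝ)) (fun i => by simp) hδ
  have h2 := expSmall_of_le_add hexp (g := fun i => -(i : ℝ)) (fun i => by simp) hδ
  have hm1 : μ.expect (fun i => (i : ℝ)) = μ.mean := by
    rw [FinMean.expect, FinMean.mean]; simp only [mul_comm]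
  have hm2 : μ.expect (fun i => -(i : ℝ)) = -μ.mean := by
    rw [FinMean.expect, FinMean.mean, ← tsum_neg]
    exact tsum_congr fun i => by ring
  obtain ⟨c, hc, C, hC⟩ := h1.union h2
  rw [hm1, hm2] at hC
  have hlim : Tendsto (fun n : ℕ => C * Real.exp (-c * n)) atTop (𝓝 0) := by
    have : Tendsto (fun n : ℕ => -c * (n : ℝ)) atTop atBot :=
      tendsto_natCast_atTop_atTop.const_mul_atTop_of_neg (by linarith)
    simpa using (Real.tendsto_exp_atBot.comp this).const_mul C
  filter_upwards [hlim.eventually (gt_mem_nhds (show (0 : ℝ) < 1 / 2 by norm_num)),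
    eventually_gt_atTop 0] with n hn hn0
  set S := range (K + 1)
  set G : Set (Fin n → ℕ) := {d | |((∑ v, d v : ℕ) : ℝ) - n * μ.mean| < n * δ} with hG
  have hhalf : 1 / 2 ≤ prodMass μ S G := by
    have huniv : prodMass μ S (Set.univ : Set (Fin n → ℕ)) = 1 := by
      rw [prodMass_univ, (hasSum_sum_of_ne_finset_zero hμ).unique μ.hasSum_mass, one_pow]
    have hcov : (Set.univ : Set (Fin n → ℕ)) ⊆ G ∪ ({d | n * (μ.mean + δ) ≤ ∑ v, (d v : ℝ)} ∪
        {d | n * (-μ.mean + δ) ≤ ∑ v, -(d v : ℝ)}) := by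
      intro d _
      by_cases hd : d ∈ G
      · exact Or.inl hd
      · right
        have hd' : ¬ |((∑ v, d v : ℕ) : ℝ) - n * μ.mean| < n * δ := hd
        rw [not_lt, le_abs] at hd'
        push_cast at hd'
        rcases hd' with h | h
        · left
          change (n : ℝ) * (μ.mean + δ) ≤ _
          linarith
        · right
          change (n : ℝ) * (-μ.mean + δ) ≤ _
          rw [sum_neg_distrib]
          linarith
    have h3 := (prodMass_mono μ S hcov).trans (prodMass_union_le μ S _ _)
    have h4 := hC n hn0 S
    rw [huniv] at h3
    linarith
  by_contra! hno
  set T := (range (n * K + 1)).filter fun s : ℕ => |(s : ℝ) - n * μ.mean| < n * δ with hT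
  have hsplit : prodMass μ S G
      = ∑ s ∈ T, prodMass μ S {d : Fin n → ℕ | ∑ v, d v = s} := by
    unfold prodMass
    have hmaps : ∀ d ∈ (Fintype.piFinset fun _ : Fin n => S).filter (· ∈ G), ∑ v, d v ∈ T := by
      intro d hd
      rw [mem_filter, Fintype.mem_piFinset] at hd
      rw [hT, mem_filter, mem_range, Nat.lt_succ_iff]
      refine ⟨?_, hd.2⟩
      calc ∑ v, d v ≤ ∑ _v : Fin n, K :=
            sum_le_sum fun v _ => Nat.lt_succ_iff.1 (mem_range.1 (hd.1 v))
        _ = n * K := by simp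
    rw [← sum_fiberwise_of_maps_to hmaps]
    refine sum_congr rfl fun s hs => ?_
    rw [filter_filter]
    refine sum_congr ?_ fun _ _ => rfl
    ext d
    simp only [mem_filter]
    constructor
    · exact fun h => ⟨h.1, h.2.2⟩
    · intro h
      have h' : ∑ v, d v = s := h.2
      refine ⟨h.1, ?_, h'⟩
      change |((∑ v, d v : ℕ) : ℝ) - n * μ.mean| < n * δ
      rw [h']
      exact (mem_filter.1 hs).2
  have hTne : T.Nonempty := by
    rw [nonempty_iff_ne_empty]
    intro h
    rw [hsplit, h, sum_empty] at hhalf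
    norm_num at hhalf
  have hlt : prodMass μ S G < T.card * (1 / (2 * (n * K + 1))) := by
    rw [hsplit, ← nsmul_eq_mul, ← sum_const]
    refine sum_lt_sum_of_nonempty hTne fun s hs => ?_
    obtain ⟨h5, h6⟩ := mem_filter.1 hs
    exact hno s (Nat.lt_succ_iff.1 (mem_range.1 h5)) h6
  have hTc : (T.card : ℝ) ≤ n * K + 1 := by
    have := card_filter_le (range (n * K + 1)) fun s : ℕ => |(s : ℝ) - n * μ.mean| < n * δ
    rw [card_range] at this
    exact_mod_cast this
  have h7 : (T.card : ℝ) * (1 / (2 * (n * K + 1))) ≤ (n * K + 1) * (1 / (2 * (n * K + 1))) := by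
    gcongr
  have h8 : ((n : ℝ) * K + 1) * (1 / (2 * (n * K + 1))) = 1 / 2 := by field_simp
  linarith

lemma edgeWeight_nonneg {β : ℝ} (hβ : 0 ≤ β) {n : ℕ} (hn : β < n) (f : ℕ → ℝ)
    (A : Finset (Sym2 (Fin n))) : 0 ≤ edgeWeight β f A := by
  have hn0 : (0 : ℝ) < n := hβ.trans_lt hn
  have : 0 ≤ 1 - β / n := by
    rw [sub_nonneg, div_le_one hn0]
    exact hn.le
  unfold edgeWeight
  positivity

lemma levelWeight_nonneg {β : ℝ} (hβ : 0 ≤ β) {n : ℕ} (hn : β < n) (f : ℕ → ℝ)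
    (B : Set (Fin n → ℕ)) (E : ℕ) : 0 ≤ levelWeight β f B E :=
  sum_nonneg fun A _ => edgeWeight_nonneg hβ hn f A

lemma levelWeight_mono {β : ℝ} (hβ : 0 ≤ β) {n : ℕ} (hn : β < n) (f : ℕ → ℝ)
    {A B : Set (Fin n → ℕ)} (h : A ⊆ B) (E : ℕ) : levelWeight β f A E ≤ levelWeight β f B E := by
  classical
  exact sum_le_sum_of_subset_of_nonneg (monotone_filter_right _ fun _ _ hd => h hd)
    fun A _ _ => edgeWeight_nonneg hβ hn f A

lemma levelWeight_univ (β : ℝ) {n : ℕ} (f : ℕ → ℝ) (E : ℕ) :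
    levelWeight β f (Set.univ : Set (Fin n → ℕ)) E
      = (β / n) ^ E * (1 - β / n) ^ (n.choose 2 - E) *
        ∑ A ∈ (allEdges n).powersetCard E, Real.exp (∑ v, f (edgeDeg A v)) := by
  classical
  unfold levelWeight
  simp only [Set.mem_univ, filter_true]
  rw [mul_sum]
  exact sum_congr rfl fun A hA => by rw [edgeWeight, (mem_powersetCard.1 hA).2]

lemma mul_log_sub_le_log_factorial (j : ℕ) :
    (j : ℝ) * Real.log (2 * j) - j ≤ Real.log (2 ^ j * j.factorial) := by
  rcases Nat.eq_zero_or_pos j with rfl | hj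
  · simp
  have hj' : (0 : ℝ) < j := by exact_mod_cast hj
  have h := Real.pow_div_factorial_le_exp (j : ℝ) hj'.le j
  have h1 := Real.log_le_log (by positivity) h
  rw [Real.log_exp, Real.log_div (by positivity) (by positivity), Real.log_pow] at h1
  rw [Real.log_mul two_ne_zero hj'.ne', Real.log_mul (by positivity) (by positivity), Real.log_pow]
  linarith

lemma neg_le_mul_log_one_sub {β : ℝ} (hβ : 0 < β) {n : ℕ} (hn : 2 * β ≤ n) (j : ℕ) :
    -(n * β / 2) - β ^ 2 ≤ ((n.choose 2 - j : ℕ) : ℝ) * Real.log (1 - β / n) := by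
  have hn0 : (0 : ℝ) < n := by linarith
  have hq : 0 < 1 - β / n := by
    rw [sub_pos, div_lt_one hn0]
    linarith
  have h1 := Real.one_sub_inv_le_log_of_pos hq
  have h2 : 1 - (1 - β / n)⁻¹ = -(β / (n - β)) := by
    have : (n : ℝ) - β ≠ 0 := by linarith
    field_simp
    ring
  have h3 : Real.log (1 - β / n) ≤ 0 :=
    Real.log_nonpos hq.le (by linarith [div_pos hβ hn0])
  have h4 : ((n.choose 2 - j : ℕ) : ℝ) ≤ n * n / 2 := by
    have : ((n.choose 2 - j : ℕ) : ℝ) ≤ (n.choose 2 : ℕ) := by exact_mod_cast Nat.sub_le _ _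
    rw [Nat.cast_choose_two] at this
    nlinarith
  have h5 : (n : ℝ) * n / 2 * (β / (n - β)) ≤ n * β / 2 + β ^ 2 := by
    rw [mul_div_assoc', div_le_iff₀ (by linarith)]
    nlinarith [mul_pos hβ hβ]
  have h6 : (n : ℝ) * n / 2 * Real.log (1 - β / n)
      ≤ ((n.choose 2 - j : ℕ) : ℝ) * Real.log (1 - β / n) := by nlinarith
  have h7 : (n : ℝ) * n / 2 * -(β / (n - β)) ≤ n * n / 2 * Real.log (1 - β / n) :=
    mul_le_mul_of_nonneg_left (by linarith) (by positivity)
  linarith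

/-- The mass of the graphs with `j` edges, in terms of the number of such graphs. -/
lemma exp_le_Z_of_count {β : ℝ} (hβ : 0 < β) {n : ℕ} (hn : 2 * β < n) {θ : ℝ≥0} (hθ : θ ≠ 0)
    {z M q : ℝ} (hz0 : 0 < z) (hM0 : 0 < M) (hq0 : 0 < q) {j R : ℕ} (hjch : j ≤ n.choose 2)
    (hcount : 2 ^ j * (j.factorial : ℝ) * (z ^ n * q) ≤ (θ : ℝ) ^ (2 * j + R) * (M * n) ^ R *
      ∑ A ∈ (allEdges n).powersetCard j, Real.exp (∑ v, F (edgeDeg A v))) :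
    Real.exp (-(n * (2 * j / n * Real.log θ - Real.log z
        - 2 * j / n / 2 * Real.log (2 * j / n * β) + (2 * j / n + β) / 2))
      - (β ^ 2 - Real.log q + R * Real.log θ + R * (Real.log M + Real.log n))) ≤ Z β F n := by
  have hn0 : (0 : ℝ) < n := by linarith
  have hθ0 : (0 : ℝ) < θ := by exact_mod_cast pos_iff_ne_zero.2 hθ
  have hq : 0 < 1 - β / n := by
    rw [sub_pos, div_lt_one hn0]
    linarith
  have hZ : (β / n) ^ j * (1 - β / n) ^ (n.choose 2 - j) *
      ∑ A ∈ (allEdges n).powersetCard j, Real.exp (∑ v, F (edgeDeg A v)) ≤ Z β F n := by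
    rw [← levelWeight_univ, Z_eq_sum_levelWeight]
    exact single_le_sum (f := fun E => levelWeight β F (Set.univ : Set (Fin n → ℕ)) E)
      (fun E _ => levelWeight_nonneg hβ.le (by linarith) F _ E)
      (mem_range.2 (Nat.lt_succ_iff.2 hjch))
  refine le_trans ?_ hZ
  generalize (∑ A ∈ (allEdges n).powersetCard j, Real.exp (∑ v, F (edgeDeg A v))) = expSum
    at hcount
  have hexpSum : 0 < expSum := by
    have h1 : 0 < (θ : ℝ) ^ (2 * j + R) * (M * n) ^ R * expSum :=
      lt_of_lt_of_le (by positivity) hcount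
    exact pos_of_mul_pos_right h1 (by positivity)
  have hlogcount := Real.log_le_log (by positivity) hcount
  rw [Real.log_mul (by positivity) (by positivity), Real.log_mul (x := z ^ n) (by positivity)
    hq0.ne', Real.log_mul (by positivity) hexpSum.ne',
    Real.log_mul (x := (θ : ℝ) ^ (2 * j + R)) (by positivity) (by positivity),
    Real.log_pow (n := n), Real.log_pow (n := 2 * j + R), Real.log_pow (n := R),
    Real.log_mul hM0.ne' hn0.ne'] at hlogcount
  have hfac := mul_log_sub_le_log_factorial j
  rw [← Real.le_log_iff_exp_le (by positivity), Real.log_mul (by positivity) hexpSum.ne',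
    Real.log_mul (x := (β / n) ^ j) (by positivity) (by positivity), Real.log_pow, Real.log_pow]
  have hone := neg_le_mul_log_one_sub hβ hn.le j
  have hlogx : (j : ℝ) * Real.log (2 * j / n * β)
      = j * Real.log (2 * j) + j * Real.log (β / n) := by
    rcases Nat.eq_zero_or_pos j with h0 | h0
    · simp [h0]
    · have : (0 : ℝ) < j := by exact_mod_cast h0
      rw [show 2 * (j : ℝ) / n * β = 2 * j * (β / n) by ring,
        Real.log_mul (by positivity) (by positivity), mul_add]
  have hrate : (n : ℝ) * (2 * j / n * Real.log θ - Real.log z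
      - 2 * j / n / 2 * Real.log (2 * j / n * β) + (2 * j / n + β) / 2)
      = 2 * j * Real.log θ - n * Real.log z
      - (j * Real.log (2 * j) + j * Real.log (β / n)) + j + n * β / 2 := by
    rw [← hlogx]
    field_simp
    ring
  rw [hrate]
  push_cast at hlogcount
  linarith

/-- The lower bound for the partition function. -/
lemma eventually_exp_le_Z {β : ℝ} (hβ : 0 < β) (hF : LinearGrowth F) {θ : ℝ≥0} (hθ : θ ≠ 0)
    {η : ℝ} (hη : 0 < η) : ∀ᶠ n : ℕ in atTop, Real.exp (-(n * (H β F hF θ + η))) ≤ Z β F n := by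
  classical
  have hθ0 : (0 : ℝ) < θ := by exact_mod_cast pos_iff_ne_zero.2 hθ
  set Ψ : ℝ → ℝ → ℝ := fun x c =>
    x * Real.log θ - c - x / 2 * Real.log (x * β) + (x + β) / 2 with hΨ
  have hΨx : ∀ c, Continuous fun x => Ψ x c := fun c => by
    have h := continuous_half_mul_log hβ
    rw [hΨ]
    fun_prop
  have hm := tendsto_mean_truncSigma hF θ
  have hlimΨ : Tendsto (fun K => Ψ (truncSigma F θ K).mean (Real.log (truncPartition F θ K))) atTop
      (𝓝 (H β F hF θ)) :=
    (((hm.mul_const _).sub (tendsto_log_truncPartition hF θ)).sub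
      (((continuous_half_mul_log hβ).tendsto _).comp hm)).add ((hm.add_const β).div_const 2)
  obtain ⟨K, hK1, hK2⟩ := ((hlimΨ.eventually
    (gt_mem_nhds (show H β F hF θ < H β F hF θ + η / 2 by linarith))).and
    (hm.eventually (lt_mem_nhds (mean_sigma_pos hF hθ)))).exists
  set μ := truncSigma F θ K with hμ
  set z := truncPartition F θ K with hz
  have hz0 : 0 < z := truncPartition_pos F θ K
  obtain ⟨δ, hδ, hball⟩ := Metric.eventually_nhds_iff.1
    ((hΨx (Real.log z)).continuousAt.eventually (gt_mem_nhds hK1))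
  set δ' := min δ μ.mean / 2 with hδ'
  have hδ'0 : 0 < δ' := by positivity
  obtain ⟨M, hM1, hM⟩ := exists_exp_le_exp_mul F K
  set R := K + K * K with hR
  have hsup : ∀ i, i ∉ range (K + 1) → μ.mass i = 0 := fun i hi => by
    rw [hμ, mass_truncSigma, truncMass, if_neg hi]
  filter_upwards [exists_degree_sum hsup hδ'0,
    eventually_add_mul_log_le (β ^ 2 + Real.log (2 * (K + 1)) + (R + 1) * |Real.log θ|
      + (R + 1) * Real.log M) (R + 2) (show 0 < η / 2 by positivity),
    tendsto_natCast_atTop_atTop.eventually_gt_atTop (2 * β), eventually_gt_atTop K,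
    (tendsto_natCast_atTop_atTop.atTop_mul_const hδ'0).eventually_gt_atTop ((R : ℝ) + 1)]
    with n hs hlog hn hnK hnR
  obtain ⟨s, hsK, hsm, hsp⟩ := hs
  have hn0 : (0 : ℝ) < n := by linarith
  have hn1 : (1 : ℝ) ≤ n := by exact_mod_cast (show 1 ≤ n by omega)
  have hδm : 2 * δ' ≤ μ.mean := by rw [hδ']; linarith [min_le_right δ μ.mean]
  have hδδ : 2 * δ' ≤ δ := by rw [hδ']; linarith [min_le_left δ μ.mean]
  have hsR : R + 1 ≤ s := by
    have h1 := (abs_lt.1 hsm).1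
    have h2 := mul_le_mul_of_nonneg_left hδm hn0.le
    have : (R : ℝ) + 1 ≤ s := by linarith
    exact_mod_cast this
  obtain ⟨j, R', hj, hR1, hR2⟩ : ∃ j R', s = 2 * j + R' ∧ R ≤ R' ∧ R' ≤ R + 1 := by
    refine ⟨(s - R) / 2, s - 2 * ((s - R) / 2), by omega, by omega, by omega⟩
  have hR2' : (R' : ℝ) ≤ R + 1 := by exact_mod_cast hR2
  have hjch : j ≤ n.choose 2 := by
    rw [Nat.choose_two_right, Nat.le_div_iff_mul_le two_pos]
    calc j * 2 ≤ s := by omega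
      _ ≤ n * K := hsK
      _ ≤ n * (n - 1) := Nat.mul_le_mul_left _ (by omega)
  set x : ℝ := 2 * j / n with hx
  have hxm : dist x μ.mean < δ := by
    rw [Real.dist_eq, hx, div_sub' hn0.ne', abs_div, abs_of_pos hn0, div_lt_iff₀ hn0]
    have h1 : (s : ℝ) = 2 * j + R' := by exact_mod_cast hj
    have h2 : |2 * (j : ℝ) - n * μ.mean| ≤ |(s : ℝ) - n * μ.mean| + R' := by
      rw [show 2 * (j : ℝ) - n * μ.mean = ((s : ℝ) - n * μ.mean) - R' by rw [h1]; ring]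
      refine (abs_sub _ _).trans ?_
      rw [abs_of_nonneg (Nat.cast_nonneg (α := ℝ) R')]
    nlinarith [mul_le_mul_of_nonneg_left hδδ hn0.le]
  have hΨlt : Ψ x (Real.log z) < H β F hF θ + η / 2 := hball hxm
  have hcount := le_sum_exp_edgeDeg (θ := θ) (hR ▸ hR1) hM1 hM j
    ((Fintype.piFinset fun _ : Fin n => range (K + 1)).filter fun d => ∑ v, d v = s) (fun d hd => by
        rw [mem_filter, Fintype.mem_piFinset] at hd
        exact ⟨fun v => Nat.lt_succ_iff.1 (mem_range.1 (hd.1 v)), hd.2.trans hj⟩)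
  have hmass : ∑ d ∈ (Fintype.piFinset fun _ : Fin n => range (K + 1)).filter
      fun d => ∑ v, d v = s, ∏ v, sigmaWeight F θ (d v)
      = z ^ n * prodMass μ (range (K + 1)) {d : Fin n → ℕ | ∑ v, d v = s} := by
    rw [prodMass, mul_sum]
    refine sum_congr (by ext; simp) fun d hd => ?_
    simp only [mem_filter, Fintype.mem_piFinset] at hd
    exact prod_sigmaWeight_eq_truncSigma F θ K hd.1
  rw [hmass] at hcount
  have hcount' : 2 ^ j * (j.factorial : ℝ) * (z ^ n * (1 / (2 * (n * K + 1))))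
      ≤ (θ : ℝ) ^ (2 * j + R') * (M * n) ^ R' *
        ∑ A ∈ (allEdges n).powersetCard j, Real.exp (∑ v, F (edgeDeg A v)) := by
    refine le_trans ?_ hcount
    gcongr
  have hM0 : 0 < M := by linarith
  refine le_trans (Real.exp_le_exp.2 ?_)
    (exp_le_Z_of_count hβ hn hθ hz0 hM0 (by positivity) hjch hcount')
  rw [one_div, Real.log_inv]
  have hKn : Real.log (2 * (n * K + 1)) ≤ Real.log (2 * (K + 1)) + Real.log n := by
    rw [← Real.log_mul (by positivity) (by positivity)]
    apply Real.log_le_log (by positivity)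
    nlinarith
  have hnlt := mul_lt_mul_of_pos_left hΨlt hn0
  rw [hΨ] at hnlt
  have hR0 : (0 : ℝ) ≤ R' := by positivity
  have e1 : (R' : ℝ) * Real.log θ ≤ (R + 1) * |Real.log θ| :=
    (mul_le_mul_of_nonneg_left (le_abs_self _) hR0).trans
      (mul_le_mul_of_nonneg_right hR2' (abs_nonneg _))
  have e2 : (R' : ℝ) * Real.log M ≤ (R + 1) * Real.log M :=
    mul_le_mul_of_nonneg_right hR2' (Real.log_nonneg hM1)
  have e3 : (R' : ℝ) * Real.log n ≤ (R + 1) * Real.log n :=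
    mul_le_mul_of_nonneg_right hR2' (Real.log_nonneg hn1)
  linarith

end LowerBound

/-! ### The limit of the free energy and concentration -/

section Main

open Finset

variable {F : ℕ → ℝ}

lemma mul_expect (γ : ℝ) (f : ℕ → ℝ) (μ : FinMean) : γ * μ.expect f = μ.expect (γ • f) := by
  rw [FinMean.expect, FinMean.expect, ← tsum_mul_left]
  exact tsum_congr fun i => by simp only [Pi.smul_apply, smul_eq_mul]; ring

lemma expect_sub_rate_sigma (β : ℝ) (hF : LinearGrowth F) (θ : ℝ≥0) :
    (((sigma F hF θ).expect F : ℝ) : EReal) - rate β (sigma F hF θ)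
      = ((-H β F hF θ : ℝ) : EReal) := by
  have h := hasSum_entropy_sigma hF θ
  rw [rate, if_pos h.summable, h.tsum_eq, H, ← EReal.coe_sub]
  congr 1
  ring

lemma iInf_H_eq {β : ℝ} {hF : LinearGrowth F} {θ₀ : ℝ≥0} (h : ∀ θ, H β F hF θ₀ ≤ H β F hF θ) :
    ⨅ θ : ℝ≥0, ((H β F hF θ : ℝ) : EReal) = (H β F hF θ₀ : ℝ) :=
  le_antisymm (iInf_le _ θ₀) (le_iInf fun θ => EReal.coe_le_coe_iff.2 (h θ))

lemma J_eq {β : ℝ} {hF : LinearGrowth F} {θ₀ : ℝ≥0} (h : ∀ θ, H β F hF θ₀ ≤ H β F hF θ) :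
    J β F hF = (H β F hF θ₀ : ℝ) := by
  rw [← iInf_H_eq h, J]
  exact iInf_congr fun θ => rate_sigma_sub β hF θ

lemma iSup_expect_sub_rate {β : ℝ} {hF : LinearGrowth F} {θ₀ : ℝ≥0}
    (h : ∀ θ, H β F hF θ₀ ≤ H β F hF θ) :
    ⨆ μ : FinMean, (((μ.expect F : ℝ) : EReal) - rate β μ) = ((-H β F hF θ₀ : ℝ) : EReal) := by
  refine le_antisymm (iSup_le fun μ => ?_) ?_
  · obtain ⟨θ, hθ⟩ := exists_mean_sigma_eq hF (mean_nonneg μ)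
    exact (expect_sub_rate_le β hF hθ).1.trans
      (EReal.coe_le_coe_iff.2 (neg_le_neg (h θ)))
  · rw [← expect_sub_rate_sigma]
    exact le_iSup (fun μ : FinMean => ((μ.expect F : ℝ) : EReal) - rate β μ) _

/-- The maximizers of the free energy are the `σ_θ` for which `θ` minimizes `H`. -/
lemma setOf_expect_sub_rate_eq {β : ℝ} {hF : LinearGrowth F} {θ₀ : ℝ≥0}
    (h : ∀ θ, H β F hF θ₀ ≤ H β F hF θ) :
    {μ : FinMean | ((μ.expect F : ℝ) : EReal) - rate β μ = ((-H β F hF θ₀ : ℝ) : EReal)}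
      = sigma F hF '' {θ | H β F hF θ = H β F hF θ₀} := by
  ext μ
  constructor
  · intro hμ
    have hμ : ((μ.expect F : ℝ) : EReal) - rate β μ = ((-H β F hF θ₀ : ℝ) : EReal) := hμ
    obtain ⟨θ, hθ⟩ := exists_mean_sigma_eq hF (mean_nonneg μ)
    obtain ⟨h1, h2⟩ := expect_sub_rate_le β hF hθ
    have heq : H β F hF θ = H β F hF θ₀ := by
      rw [hμ, EReal.coe_le_coe_iff] at h1
      linarith [h θ]
    exact ⟨θ, heq, (h2 (by rw [hμ, heq])).symm⟩
  · rintro ⟨θ, hθ, rfl⟩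
    have hθ : H β F hF θ = H β F hF θ₀ := hθ
    change _ = _
    rw [expect_sub_rate_sigma, hθ]

lemma sum_range_choose_le {n : ℕ} (hn : 0 < n) {g : ℕ → ℝ} {a : ℝ}
    (h : ∀ E ≤ n.choose 2, g E ≤ Real.exp (-(n * a))) :
    ∑ E ∈ range (n.choose 2 + 1), g E ≤ Real.exp (2 * Real.log n - n * a) := by
  calc ∑ E ∈ range (n.choose 2 + 1), g E
      ≤ ∑ _E ∈ range (n.choose 2 + 1), Real.exp (-(n * a)) :=
        sum_le_sum fun E hE => h E (Nat.lt_succ_iff.1 (mem_range.1 hE))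
    _ = ((n.choose 2 : ℝ) + 1) * Real.exp (-(n * a)) := by
        rw [sum_const, card_range, nsmul_eq_mul]; push_cast; ring
    _ ≤ Real.exp (2 * Real.log n) * Real.exp (-(n * a)) := by
        gcongr
        exact choose_two_add_one_le hn
    _ = _ := by rw [← Real.exp_add, sub_eq_add_neg]

/-- The upper bound for the partition function. -/
lemma eventually_Z_le {β : ℝ} (hβ : 0 < β) (hF : LinearGrowth F) {b : ℝ}
    (hb : ∀ θ, b ≤ H β F hF θ) {η : ℝ} (hη : 0 < η) :
    ∀ᶠ n : ℕ in atTop, Z β F n ≤ Real.exp (-(n * (b - η))) := by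
  filter_upwards [eventually_levelWeight_le hβ hF (D := Set.univ) (fun θ _ => hb θ)
    (show 0 < η / 2 by positivity), eventually_add_mul_log_le 0 2 (show 0 < η / 2 by positivity),
    eventually_gt_atTop 0] with n hn hlog hn0
  rw [Z_eq_sum_levelWeight]
  refine (sum_range_choose_le hn0 (a := b - η / 2) fun E hE => ?_).trans
    (Real.exp_le_exp.2 (by linarith))
  obtain ⟨θ, hθ⟩ := exists_mean_sigma_eq hF (show (0 : ℝ) ≤ 2 * E / n by positivity)
  exact hn _ E hE θ trivial hθ

lemma minimizer_ne_zero {β : ℝ} (hβ : 0 < β) {hF : LinearGrowth F} {θ₀ : ℝ≥0}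
    (h : ∀ θ, H β F hF θ₀ ≤ H β F hF θ) : θ₀ ≠ 0 := by
  rintro rfl
  obtain ⟨θ, hθ⟩ := exists_H_lt_H_zero hβ hF
  exact (h θ).not_gt hθ

lemma tendsto_log_Z {β : ℝ} (hβ : 0 < β) (hF : LinearGrowth F) {θ₀ : ℝ≥0}
    (h : ∀ θ, H β F hF θ₀ ≤ H β F hF θ) :
    Tendsto (fun n : ℕ => (1 / (n : ℝ)) * Real.log (Z β F n)) atTop (𝓝 (-H β F hF θ₀)) := by
  rw [Metric.tendsto_atTop']
  intro ε hε
  have hev := (eventually_Z_le hβ hF h (show 0 < ε / 2 by positivity)).and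
    ((eventually_exp_le_Z hβ hF (minimizer_ne_zero hβ h) (show 0 < ε / 2 by positivity)).and
      (eventually_gt_atTop 0))
  obtain ⟨N, hN⟩ := eventually_atTop.1 hev
  refine ⟨N, fun n hn => ?_⟩
  obtain ⟨h1, h2, h3⟩ := hN n hn.le
  have hn0 : (0 : ℝ) < n := by exact_mod_cast h3
  have hZ : 0 < Z β F n := (Real.exp_pos _).trans_le h2
  have h4 := (Real.log_le_iff_le_exp hZ).2 h1
  have h5 := (Real.le_log_iff_exp_le hZ).2 h2
  rw [Real.dist_eq, abs_lt, one_div, ← div_eq_inv_mul]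
  constructor
  · rw [lt_sub_iff_add_lt, lt_div_iff₀ hn0]
    nlinarith
  · rw [sub_lt_iff_lt_add, div_lt_iff₀ hn0]
    nlinarith

/-- Degree distributions that stay away from all maximizers have exponentially smaller mass. -/
lemma exists_sum_levelWeight_le {β : ℝ} (hβ : 0 < β) (hF : LinearGrowth F) {θ₀ : ℝ≥0}
    (h : ∀ θ, H β F hF θ₀ ≤ H β F hF θ) {ε : ℝ≥0 → ℝ} (hε : ∀ θ, 0 < ε θ) :
    ∃ c > 0, ∀ᶠ n : ℕ in atTop, ∑ E ∈ range (n.choose 2 + 1), levelWeight β F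
      {d : Fin n → ℕ | ∀ θ, H β F hF θ = H β F hF θ₀ → ε θ ≤ empDist d (sigma F hF θ)} E
        ≤ Real.exp (2 * Real.log n - n * (H β F hF θ₀ + c)) := by
  set b := H β F hF θ₀ with hb
  have hfin := finite_minimizers hβ hF h
  have hne : ∀ θ, H β F hF θ = b → θ ≠ 0 := fun θ hθ =>
    minimizer_ne_zero hβ fun t => by rw [hθ]; exact h t
  have hloc : ∀ θ, ∃ c > 0, ∃ δ > 0, H β F hF θ = b → ∀ᶠ n : ℕ in atTop, ∀ E ≤ n.choose 2,
      |2 * E / n - (sigma F hF θ).mean| < δ →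
      levelWeight β F {d : Fin n → ℕ | ε θ ≤ empDist d (sigma F hF θ)} E
        ≤ Real.exp (-(n * (b + c))) := by
    intro θ
    by_cases hθ : H β F hF θ = b
    · obtain ⟨c, hc, δ, hδ, hev⟩ := exists_levelWeight_empDist_le hβ hF (hne θ hθ) (hε θ)
      exact ⟨c, hc, δ, hδ, fun _ => hθ ▸ hev⟩
    · exact ⟨1, one_pos, 1, one_pos, fun h => absurd h hθ⟩
  choose c hc δ hδ hev using hloc
  obtain ⟨θ₁, hθ₁, hmin⟩ := Finset.exists_min_image hfin.toFinset c ⟨θ₀, by simp [hb]⟩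
  set D : Set ℝ≥0 := {t | ∀ θ, H β F hF θ = b →
    δ θ ≤ |(sigma F hF t).mean - (sigma F hF θ).mean|} with hD
  have hDcl : IsClosed D := by
    simp only [hD, Set.ofPred_forall]
    exact isClosed_iInter fun θ => isClosed_iInter fun _ =>
      isClosed_le continuous_const ((continuous_mean_sigma hF).sub continuous_const).abs
  obtain ⟨a, ha, hDa⟩ : ∃ a > 0, ∀ t ∈ D, b + 2 * a ≤ H β F hF t := by
    rcases D.eq_empty_or_nonempty with hemp | hnon
    · exact ⟨1, one_pos, fun t ht => by simp [hemp] at ht⟩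
    · obtain ⟨t₀, ht₀, hmin₀⟩ := exists_minimizer_on_closed hβ hF hDcl hnon
      have hlt : b < H β F hF t₀ := by
        refine lt_of_le_of_ne (h t₀) fun heq => ?_
        have := ht₀ t₀ heq.symm
        rw [sub_self, abs_zero] at this
        exact (hδ t₀).not_ge this
      exact ⟨(H β F hF t₀ - b) / 2, by linarith, fun t ht => by linarith [hmin₀ t ht]⟩
  have hall : ∀ᶠ n : ℕ in atTop, ∀ θ ∈ {θ | H β F hF θ = b}, ∀ E ≤ n.choose 2,
      |2 * E / n - (sigma F hF θ).mean| < δ θ →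
      levelWeight β F {d : Fin n → ℕ | ε θ ≤ empDist d (sigma F hF θ)} E
        ≤ Real.exp (-(n * (b + c θ))) :=
    (eventually_all_finite hfin).2 fun θ hθ => hev θ hθ
  refine ⟨min (c θ₁) a, lt_min (hc θ₁) ha, ?_⟩
  filter_upwards [hall, eventually_levelWeight_le hβ hF hDa ha, eventually_gt_atTop 0,
    tendsto_natCast_atTop_atTop.eventually_gt_atTop β] with n hnear hfar hn0 hn
  have hn0' : (0 : ℝ) < n := by exact_mod_cast hn0
  refine sum_range_choose_le hn0 fun E hE => ?_
  obtain ⟨t, ht⟩ := exists_mean_sigma_eq hF (show (0 : ℝ) ≤ 2 * E / n by positivity)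
  by_cases htD : t ∈ D
  · refine (hfar _ E hE t htD ht).trans (Real.exp_le_exp.2 (neg_le_neg ?_))
    have := min_le_right (c θ₁) a
    exact mul_le_mul_of_nonneg_left (by linarith) hn0'.le
  · simp only [hD, Set.mem_ofPred_eq, not_forall, not_le] at htD
    obtain ⟨θ, hθ, hlt⟩ := htD
    rw [ht] at hlt
    have hsub : {d : Fin n → ℕ | ∀ θ, H β F hF θ = b → ε θ ≤ empDist d (sigma F hF θ)} ⊆
        {d | ε θ ≤ empDist d (sigma F hF θ)} := fun d hd => hd θ hθ
    refine (levelWeight_mono hβ.le hn F hsub E).trans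
      ((hnear θ hθ E hE hlt).trans (Real.exp_le_exp.2 (neg_le_neg ?_)))
    have h1 := min_le_left (c θ₁) a
    have h2 := hmin θ (hfin.mem_toFinset.2 hθ)
    exact mul_le_mul_of_nonneg_left (by linarith) hn0'.le

lemma dist_empirical {n : ℕ} [NeZero n] (G : SimpleGraph (Fin n)) (μ : FinMean) :
    dist (empirical G) μ = empDist (degrees G) μ := by
  change ∑' i : ℕ, (i : ℝ) * |(empirical G).mass i - μ.mass i| = _
  refine tsum_congr fun i => ?_
  rw [empirical, FinMean.mass_ofMass, degFreq_eq_card]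

lemma tendsto_Q {β : ℝ} (hβ : 0 < β) (hF : LinearGrowth F) {θ₀ : ℝ≥0}
    (h : ∀ θ, H β F hF θ₀ ≤ H β F hF θ) {U : Set FinMean} (hU : IsOpen U)
    (hsub : sigma F hF '' {θ | H β F hF θ = H β F hF θ₀} ⊆ U) :
    Tendsto (fun n : ℕ => Q β F (n + 1) {G | empirical G ∉ U}) atTop (𝓝 0) := by
  classical
  have hball : ∀ θ, ∃ ε > 0, H β F hF θ = H β F hF θ₀ → Metric.ball (sigma F hF θ) ε ⊆ U := by
    intro θ
    by_cases hθ : H β F hF θ = H β F hF θ₀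
    · obtain ⟨ε, hε, hb⟩ := Metric.isOpen_iff.1 hU _ (hsub ⟨θ, hθ, rfl⟩)
      exact ⟨ε, hε, fun _ => hb⟩
    · exact ⟨1, one_pos, fun h => absurd h hθ⟩
  choose ε hε hεU using hball
  obtain ⟨c, hc, hlevel⟩ := exists_sum_levelWeight_le hβ hF h hε
  have hZ := eventually_exp_le_Z hβ hF (minimizer_ne_zero hβ h) (show 0 < c / 4 by positivity)
  have hbound : ∀ᶠ n : ℕ in atTop, Real.exp (2 * Real.log n - n * (H β F hF θ₀ + c)) ≤
      Real.exp (-(c / 2) * n) * Real.exp (-(n * (H β F hF θ₀ + c / 4))) := by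
    filter_upwards [eventually_add_mul_log_le 0 2 (show 0 < c / 4 by positivity)] with n hn
    rw [← Real.exp_add]
    apply Real.exp_le_exp.2
    linarith
  have hlim : Tendsto (fun n : ℕ => Real.exp (-(c / 2) * n)) atTop (𝓝 0) :=
    Real.tendsto_exp_atBot.comp
      (tendsto_natCast_atTop_atTop.const_mul_atTop_of_neg (by linarith))
  have hbn := tendsto_natCast_atTop_atTop.eventually_gt_atTop (α := ℕ) β
  refine tendsto_of_tendsto_of_tendsto_of_le_of_le' tendsto_const_nhds
    (hlim.comp (tendsto_add_atTop_nat 1)) ?_ ?_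
  · filter_upwards [(tendsto_add_atTop_nat 1).eventually hZ,
      (tendsto_add_atTop_nat 1).eventually hbn] with n hn1 hn2
    refine sum_nonneg fun G _ => div_nonneg ?_ ((Real.exp_pos _).le.trans hn1)
    rw [graphWeight_eq_edgeWeight]
    exact edgeWeight_nonneg hβ.le hn2 F _
  · filter_upwards [(tendsto_add_atTop_nat 1).eventually hZ,
      (tendsto_add_atTop_nat 1).eventually hbn, (tendsto_add_atTop_nat 1).eventually hlevel,
      (tendsto_add_atTop_nat 1).eventually hbound] with n hn1 hn2 hn3 hn4
    have hZ0 : 0 < Z β F (n + 1) := (Real.exp_pos _).trans_le hn1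
    unfold Q
    rw [← sum_div, div_le_iff₀ hZ0]
    calc _ ≤ ∑ G : SimpleGraph (Fin (n + 1)) with degrees G ∈ {d : Fin (n + 1) → ℕ |
          ∀ θ, H β F hF θ = H β F hF θ₀ → ε θ ≤ empDist d (sigma F hF θ)},
          graphWeight β F G := by
          refine sum_le_sum_of_subset_of_nonneg (fun G hG => ?_) fun G _ _ => ?_
          · simp only [mem_filter, mem_univ, true_and, Set.mem_ofPred_eq] at hG ⊢
            intro θ hθ
            rw [← dist_empirical]
            by_contra hlt
            exact hG (hεU θ hθ (Metric.mem_ball.2 (not_le.1 hlt)))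
          · rw [graphWeight_eq_edgeWeight]
            exact edgeWeight_nonneg hβ.le hn2 F _
      _ ≤ _ := by
          rw [sum_graphWeight]
          exact hn3
      _ ≤ _ := hn4
      _ ≤ _ := mul_le_mul_of_nonneg_left hn1 (Real.exp_pos _).le

end Main

end DegreeLDP

end

theorem theorem1p5 (β : ℝ) (hβ : 0 < β) (γ : ℝ) (f : ℕ → ℝ)
    (hf : DegreeLDP.LinearGrowth f) :
    (∃ L : ℝ,
      Tendsto (fun n : ℕ => (1 / (n : ℝ)) * Real.log (DegreeLDP.Z β (γ • f) n)) atTop (𝓝 L) ∧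
      (L : EReal) = ⨆ μ : DegreeLDP.FinMean,
        (((γ * μ.expect f : ℝ) : EReal) - DegreeLDP.rate β μ) ∧
      (L : EReal) = - DegreeLDP.J β (γ • f) (hf.const_smul γ) ∧
      (L : EReal) = - ⨅ θ : ℝ≥0, ((DegreeLDP.H β (γ • f) (hf.const_smul γ) θ : ℝ) : EReal)) ∧
    (DegreeLDP.maximizers β γ f).Finite ∧
    (DegreeLDP.maximizers β γ f).Nonempty ∧
    DegreeLDP.maximizers β γ f ⊆ DegreeLDP.Omega (γ • f) (hf.const_smul γ) ∧
    ∀ U : Set DegreeLDP.FinMean, IsOpen U → DegreeLDP.maximizers β γ f ⊆ U →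
      Tendsto (fun n : ℕ => DegreeLDP.Q β (γ • f) (n + 1) {G | DegreeLDP.empirical G ∉ U})
        atTop (𝓝 0) := by
  have hF := hf.const_smul γ
  obtain ⟨θ₀, -, h⟩ := DegreeLDP.exists_minimizer_on_closed hβ hF isClosed_univ Set.univ_nonempty
  replace h : ∀ θ, DegreeLDP.H β (γ • f) hF θ₀ ≤ DegreeLDP.H β (γ • f) hF θ := fun θ => h θ trivial
  have hmax : DegreeLDP.maximizers β γ f = DegreeLDP.sigma (γ • f) hF ''
      {θ | DegreeLDP.H β (γ • f) hF θ = DegreeLDP.H β (γ • f) hF θ₀} := by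
    rw [← DegreeLDP.setOf_expect_sub_rate_eq h, ← DegreeLDP.iSup_expect_sub_rate h,
      DegreeLDP.maximizers]
    simp only [DegreeLDP.mul_expect]
  refine ⟨⟨-DegreeLDP.H β (γ • f) hF θ₀, DegreeLDP.tendsto_log_Z hβ hF h, ?_, ?_, ?_⟩,
    ?_, ?_, ?_, ?_⟩
  · simp only [DegreeLDP.mul_expect]
    rw [DegreeLDP.iSup_expect_sub_rate h]
  · rw [DegreeLDP.J_eq h, EReal.coe_neg]
  · rw [DegreeLDP.iInf_H_eq h, EReal.coe_neg]
  · rw [hmax]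
    exact (DegreeLDP.finite_minimizers hβ hF h).image _
  · rw [hmax]
    exact ⟨_, θ₀, rfl, rfl⟩
  · rw [hmax]
    exact Set.image_subset_range _ _
  · intro U hU hsub
    exact DegreeLDP.tendsto_Q hβ hF h hU (hmax ▸ hsub)
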